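/- Let $B_{1,n}=\langle t,\sigma_1,\dots,\sigma_{n-1}\rangle$ ($n\ge 1$) be the Artin group of type B (mixed braids with $n$ moving strands), i.e. the group with relations $\sigma_1t\sigma_1t=t\sigma_1t\sigma_1$, $t\sigma_i=\sigma_it$ ($i>1$) and the braid relations among the $\sigma_i$. Put $t_0=t'_0=t$, $t_i=\sigma_i t_{i-1}\sigma_i$, $t'_i=\sigma_i t'_{i-1}\sigma_i^{-1}$. Let $K$ be a field containing elements $q,z$ that are algebraically independent over $\mathbb Z$ and a square root $\sqrt\lambda$ of $\lambda=\frac{z+1-q}{qz}$, and let $s_0=1$ and $s_k$ ($k\in\mathbb Z\setminus\{0\}$) be indeterminates. Let $\mathrm H_{1,n}(q)$ be the quotient of the group algebra of $B_{1,n}$ over $K[s_k]$ by the relations $\sigma_i^2=(q-1)\sigma_i+q$, let $\pi$ be the canonical map from $B_{1,n}$, with $g_i=\pi(\sigma_i)$, and let $\mathrm{tr}$ be the universal $K[s_k]$-linear Markov trace on $\bigcup_n \mathrm H_{1,n}(q)$, subject to $$\mathrm{tr}(ab)=\mathrm{tr}(ba),\qquad \mathrm{tr}(a g_n)=z\,\mathrm{tr}(a),\qquad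 \mathrm{tr}(a\,{t'_n}^k)=s_k\,\mathrm{tr}(a)\qquad (a,b\in \mathrm H_{1,n}(q),\ k\in\mathbb Z);$$ its values lie in the $K[s_k]$-module generated by the symbols $\mathrm{tr}(a)$ modulo these rules, in which $\mathrm{tr}(1)$ plays the role of $1$. For $\alpha\in B_{1,n}$ let $$X_{\widehat\alpha}=\Bigl[-\tfrac{1-\lambda q}{\sqrt\lambda(1-q)}\Bigr]^{n-1}(\sqrt\lambda)^{e}\,\mathrm{tr}(\pi(\alpha)),$$ where $e$ is the exponent sum of the $\sigma_i$'s in $\alpha$. Fix $p\in\mathbb Z$. For $\alpha\in B_{1,n}$ let $\alpha_+\in B_{1,n+1}$ be the image of $\alpha$ under $\sigma_i\mapsto\sigma_{i+1}$, $t\mapsto t_1$. The result of a braid band move (bbm) of sign $\pm$ on the first moving strand is $sl_{\pm1}(\alpha)=t^p\sigma_1^{\pm1}\alpha_+$, and on the $i$-th moving strand, $1\le i\le n$, it is $sl_{\pm i}(\alpha)=sl_{\pm1}\bigl((\sigma_1^{-1}\cdots\sigma_{i-1}^{-1})\,\alpha\,(\sigma_{i-1}\cdots\sigma_1)\bigr)$.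 For a set $S$ of mixed braids, the system of $S$ consists of all equations $X_{\widehat\alpha}=X_{\widehat{sl_{\pm i}(\alpha)}}$ with $\alpha\in S$, either sign, and any moving strand $i$ of $\alpha$. Two systems are equivalent if each equation of either one is a $K$-linear combination of equations of the other, an equation being identified with the difference of its two sides. Let $L$ be the set of all monomials $t_0^{k_0}t_1^{k_1}\cdots t_m^{k_m}\in B_{1,m+1}$ ($m\ge0$) with all $k_i\ne0$, together with the unknot $t^0\in B_{1,1}$; let $\Lambda\subset L$ consist of those with $k_0\ge k_1\ge\cdots\ge k_m$ (including $t^0$). Let $\Lambda\cdot\mathrm{tails}$ be the set of all $\tau w\in B_{1,n}$ ($n\ge1$), where $\tau\in\Lambda$ has at most $n$ moving strands and $w$ is a word in $\sigma_1^{\pm1},\dots,\sigma_{n-1}^{\pm1}$. Then the system of $\Lambda\cdot\mathrm{tails}$ is equivalent to the system of $L$, and it is also equivalent to the system of $\Lambda$. -/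

import Mathlib

open scoped DirectSum

noncomputable section

/-! ### The Artin braid groups of type B -/

/-- Generators of the mixed braid group `B_{1,m+1}` on one fixed and `m + 1` moving strands:
the loop `t` and `σ_1, …, σ_m`.  The constructor `s i` stands for `σ_{i+1}`, as `i` starts at `0`. -/
inductive BGen (m : ℕ) : Type
  | t : BGen m
  | s (i : Fin m) : BGen m

/-- The defining relations of `B_{1,m+1}`. -/
inductive BRel (m : ℕ) : FreeGroup (BGen m) → Prop
  | loop (i : Fin m) (hi : (i : ℕ) = 0) : BRel m
      ((.of (.s i) * .of .t * .of (.s i) * .of .t) * (.of .t * .of (.s i) * .of .t * .of (.s i))⁻¹)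
  | comm (i : Fin m) (hi : 0 < (i : ℕ)) : BRel m
      ((.of .t * .of (.s i)) * (.of (.s i) * .of .t)⁻¹)
  | braid (i j : Fin m) (hij : (i : ℕ) + 1 = j) : BRel m
      ((.of (.s i) * .of (.s j) * .of (.s i)) * (.of (.s j) * .of (.s i) * .of (.s j))⁻¹)
  | far (i j : Fin m) (hij : (i : ℕ) + 1 < j) : BRel m
      ((.of (.s i) * .of (.s j)) * (.of (.s j) * .of (.s i))⁻¹)

/-- The Artin group of type B, `B_{1,m+1}`: mixed braids with `m + 1` moving strands. -/
abbrev ArtinB (m : ℕ) : Type := PresentedGroup {x | BRel m x}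

namespace ArtinB

variable {m : ℕ}

/-- The looping generator `t`. -/
def t : ArtinB m := PresentedGroup.of .t

/-- The braiding generator `σ_{i+1}`. -/
def σ (i : Fin m) : ArtinB m := PresentedGroup.of (.s i)

theorem rel_loop (i : Fin m) (hi : (i : ℕ) = 0) :
    σ i * t * σ i * t = t * σ i * t * σ i := by
  have h := PresentedGroup.one_of_mem (rels := {x | BRel m x}) (BRel.loop i hi)
  rw [map_mul, map_inv] at h
  exact mul_inv_eq_one.mp h

theorem rel_comm (i : Fin m) (hi : 0 < (i : ℕ)) : t * σ i = σ i * t := by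
  have h := PresentedGroup.one_of_mem (rels := {x | BRel m x}) (BRel.comm i hi)
  rw [map_mul, map_inv] at h
  exact mul_inv_eq_one.mp h

theorem rel_braid (i j : Fin m) (hij : (i : ℕ) + 1 = j) :
    σ i * σ j * σ i = σ j * σ i * σ j := by
  have h := PresentedGroup.one_of_mem (rels := {x | BRel m x}) (BRel.braid i j hij)
  rw [map_mul, map_inv] at h
  exact mul_inv_eq_one.mp h

theorem rel_far (i j : Fin m) (hij : (i : ℕ) + 1 < j) : σ i * σ j = σ j * σ i := by
  have h := PresentedGroup.one_of_mem (rels := {x | BRel m x}) (BRel.far i j hij)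
  rw [map_mul, map_inv] at h
  exact mul_inv_eq_one.mp h

/-- A homomorphism out of `B_{1,m+1}` from images of the generators that satisfy the relations. -/
def lift {G : Type*} [Group G] (a : G) (b : Fin m → G)
    (h1 : ∀ i : Fin m, (i : ℕ) = 0 → b i * a * b i * a = a * b i * a * b i)
    (h2 : ∀ i : Fin m, 0 < (i : ℕ) → a * b i = b i * a)
    (h3 : ∀ i j : Fin m, (i : ℕ) + 1 = j → b i * b j * b i = b j * b i * b j)
    (h4 : ∀ i j : Fin m, (i : ℕ) + 1 < j → b i * b j = b j * b i) : ArtinB m →* G :=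
  PresentedGroup.toGroup (f := fun g => match g with | .t => a | .s i => b i) (by
    intro r hr
    cases hr with
    | loop i hi => simpa using mul_inv_eq_one.mpr (h1 i hi)
    | comm i hi => simpa using mul_inv_eq_one.mpr (h2 i hi)
    | braid i j hij => simpa using mul_inv_eq_one.mpr (h3 i j hij)
    | far i j hij => simpa using mul_inv_eq_one.mpr (h4 i j hij))

/-- The natural inclusion `B_{1,m+1} → B_{1,m+2}`, adding a moving strand on the right. -/
def incl : ArtinB m →* ArtinB (m + 1) :=
  lift t (fun i => σ i.castSucc)
    (fun i hi => rel_loop _ (by simpa using hi))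
    (fun i hi => rel_comm _ (by simpa using hi))
    (fun i j h => rel_braid _ _ (by simpa using h))
    (fun i j h => rel_far _ _ (by simpa using h))

theorem shift_aux {G : Type*} [Group G] {a b t : G} (h1 : a * t * a * t = t * a * t * a)
    (h2 : t * b = b * t) (h3 : a * b * a = b * a * b) :
    b * (a * t * a) * b * (a * t * a) = (a * t * a) * b * (a * t * a) * b :=
  calc b * (a * t * a) * b * (a * t * a) = b * a * t * (a * b * a) * t * a := by group
    _ = b * a * (t * b) * a * (b * t) * a := by rw [h3]; group
    _ = (b * a * b) * t * a * t * (b * a) := by rw [h2, ← h2]; group; simp [h2, mul_assoc]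
    _ = a * b * (a * t * a * t) * (b * a) := by rw [← h3]; group
    _ = a * (b * t) * a * t * (a * b * a) := by rw [h1]; group
    _ = a * (t * b) * a * t * (b * a * b) := by rw [h3, h2]
    _ = a * t * b * a * (t * b) * a * b := by group
    _ = a * t * (b * a * b) * t * a * b := by rw [h2]; group
    _ = (a * t * a) * b * (a * t * a) * b := by rw [← h3]; group

/-- `α ↦ α_+`: all indices are shifted by one, that is `σ_i ↦ σ_{i+1}` and
`t = t_0 ↦ t_1 = σ_1 t σ_1`. -/
def shift : ArtinB m →* ArtinB (m + 1) :=
  lift (σ 0 * t * σ 0) (fun i => σ i.succ)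
    (fun i hi => shift_aux (rel_loop 0 rfl) (rel_comm _ (by simp))
      (rel_braid _ _ (by simp [hi])))
    (fun i hi => by
      have h1 : σ (0 : Fin (m + 1)) * σ i.succ = σ i.succ * σ 0 := rel_far _ _ (by simpa using hi)
      have h2 : t * σ i.succ = σ i.succ * t := rel_comm _ (by simp)
      calc σ 0 * t * σ 0 * σ i.succ = σ 0 * t * (σ 0 * σ i.succ) := by group
        _ = σ 0 * (t * σ i.succ) * σ 0 := by rw [h1]; group
        _ = (σ 0 * σ i.succ) * t * σ 0 := by rw [h2]; group
        _ = σ i.succ * (σ 0 * t * σ 0) := by rw [h1]; group)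
    (fun i j h => rel_braid _ _ (by simpa using h))
    (fun i j h => rel_far _ _ (by simpa using h))

/-- The exponent sum of the `σ_i`'s in a mixed braid. -/
def expSum : ArtinB m →* Multiplicative ℤ :=
  lift 1 (fun _ => Multiplicative.ofAdd 1) (by simp) (by simp) (by simp) (by simp)

/-- `t_i = σ_i ⋯ σ_1 t σ_1 ⋯ σ_i`, for `0 ≤ i ≤ m`. -/
def tt (i : Fin (m + 1)) : ArtinB m :=
  Fin.induction (motive := fun _ => ArtinB m) t (fun j x => σ j * x * σ j) i

/-- `t'_i = σ_i ⋯ σ_1 t σ_1⁻¹ ⋯ σ_i⁻¹`, for `0 ≤ i ≤ m`. -/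
def tt' (i : Fin (m + 1)) : ArtinB m :=
  Fin.induction (motive := fun _ => ArtinB m) t (fun j x => σ j * x * (σ j)⁻¹) i

/-- `σ_i σ_{i-1} ⋯ σ_1`, for `0 ≤ i ≤ m`; for `i = 0` the empty product. -/
def desc (i : Fin (m + 1)) : ArtinB m :=
  Fin.induction (motive := fun _ => ArtinB m) 1 (fun j x => σ j * x) i

/-- The monomial `t_0^{k_0} t_1^{k_1} ⋯ t_j^{k_j}` as a mixed braid with `m + 1 ≥ j + 1` moving
strands. -/
def mono {j : ℕ} (h : j ≤ m) (k : Fin (j + 1) → ℤ) : ArtinB m :=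
  (List.ofFn fun i : Fin (j + 1) => tt (i.castLE (Nat.succ_le_succ h)) ^ k i).prod

/-- The result `t^p σ_1^ε α_+` of a braid band move of sign `ε` on the first moving strand. -/
def slFirst (p : ℤ) (ε : ℤˣ) (α : ArtinB m) : ArtinB (m + 1) :=
  t ^ p * σ 0 ^ (ε : ℤ) * shift α

/-- The result `sl_{±(i+1)}(α)` of a braid band move of sign `ε` on the moving strand number `i + 1`:
that strand is first brought to the first place by conjugation with `σ_i ⋯ σ_1`. -/
def sl (p : ℤ) (ε : ℤˣ) (i : Fin (m + 1)) (α : ArtinB m) : ArtinB (m + 1) :=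
  slFirst p ε ((desc i)⁻¹ * α * desc i)

end ArtinB

/-! ### The generalized Iwahori-Hecke algebras of type B -/

/-- The quadratic relations `σ_i² = (q - 1) σ_i + q`. -/
inductive HeckeRel (R : Type*) [CommRing R] (q : R) (m : ℕ) :
    MonoidAlgebra R (ArtinB m) → MonoidAlgebra R (ArtinB m) → Prop
  | quad (i : Fin m) : HeckeRel R q m (MonoidAlgebra.of R _ (ArtinB.σ i) ^ 2)
      ((q - 1) • MonoidAlgebra.of R _ (ArtinB.σ i) + q • 1)

/-- The generalized Iwahori-Hecke algebra of type B, `H_{1,m+1}(q)`, with coefficients in `R`. -/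
def HeckeB (R : Type*) [CommRing R] (q : R) (m : ℕ) : Type _ := RingQuot (HeckeRel R q m)

instance (R : Type*) [CommRing R] (q : R) (m : ℕ) : Ring (HeckeB R q m) :=
  inferInstanceAs (Ring (RingQuot (HeckeRel R q m)))

instance (R : Type*) [CommRing R] (q : R) (m : ℕ) : Algebra R (HeckeB R q m) :=
  inferInstanceAs (Algebra R (RingQuot (HeckeRel R q m)))

namespace HeckeB

variable (R : Type*) [CommRing R] (q : R) (m : ℕ)

/-- The quotient map from the group algebra of `B_{1,m+1}`. -/
def mk : MonoidAlgebra R (ArtinB m) →ₐ[R] HeckeB R q m :=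
  RingQuot.mkAlgHom R (HeckeRel R q m)

/-- The canonical map `π : B_{1,m+1} → H_{1,m+1}(q)`, `t ↦ t`, `σ_i ↦ g_i`. -/
def π : ArtinB m →* HeckeB R q m :=
  (mk R q m : MonoidAlgebra R (ArtinB m) →* HeckeB R q m).comp (MonoidAlgebra.of R (ArtinB m))

/-- The natural map `H_{1,m+1}(q) → H_{1,m+2}(q)`. -/
def incl : HeckeB R q m →ₐ[R] HeckeB R q (m + 1) :=
  RingQuot.liftAlgHom R (s := HeckeRel R q m) ⟨MonoidAlgebra.lift R (HeckeB R q (m + 1)) (ArtinB m)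
      ((π R q (m + 1)).comp ArtinB.incl), by
    rintro _ _ ⟨i⟩
    have h : mk R q (m + 1) _ = mk R q (m + 1) _ :=
      RingQuot.mkAlgHom_rel R (HeckeRel.quad (R := R) (q := q) (m := m + 1) i.castSucc)
    have hi : ArtinB.incl (ArtinB.σ i) = ArtinB.σ i.castSucc := by
      simp [ArtinB.incl, ArtinB.lift, ArtinB.σ]
    rw [map_pow, map_add, map_smul, map_smul, map_one] at h ⊢
    rw [MonoidAlgebra.lift_of, MonoidHom.comp_apply, hi]
    exact h⟩

end HeckeB

/-! ### The Markov trace and the invariant `X` -/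

section Trace

variable (K : Type*) [Field K]

/-- The ring of polynomials over `K` in the indeterminates `s_k`, `k ∈ ℤ ∖ {0}`. -/
abbrev SRing : Type _ := MvPolynomial {k : ℤ // k ≠ 0} K

/-- The elements `s_k`, `k ∈ ℤ`, with `s_0 = 1`. -/
def sVar (k : ℤ) : SRing K := if h : k = 0 then 1 else MvPolynomial.X ⟨k, h⟩

/-- `H_{1,m+1}(q)` with coefficients extended to `K[s_k]`. -/
abbrev HAlg (q : K) (m : ℕ) : Type _ := HeckeB (SRing K) (MvPolynomial.C q) m

/-- The `K[s_k]`-linear relations that a Markov trace on `⋃_n H_{1,n}(q)` with parameters `z`, `s_k`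
has to satisfy. -/
inductive MarkovRel (q z : K) : (⨁ m, HAlg K q m) → Prop
  /-- The trace is defined on the union of the algebras. -/
  | union (m : ℕ) (a : HAlg K q m) : MarkovRel q z
      (DirectSum.lof (SRing K) ℕ (HAlg K q) (m + 1) (HeckeB.incl _ _ m a) -
        DirectSum.lof (SRing K) ℕ (HAlg K q) m a)
  /-- `tr(ab) = tr(ba)`. -/
  | cyclic (m : ℕ) (a b : HAlg K q m) : MarkovRel q z
      (DirectSum.lof (SRing K) ℕ (HAlg K q) m (a * b) -
        DirectSum.lof (SRing K) ℕ (HAlg K q) m (b * a))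
  /-- `tr(a g_n) = z tr(a)` for `a ∈ H_{1,n}(q)`, `n = m + 1`. -/
  | stab (m : ℕ) (a : HAlg K q m) : MarkovRel q z
      (DirectSum.lof (SRing K) ℕ (HAlg K q) (m + 1)
          (HeckeB.incl _ _ m a * HeckeB.π _ _ _ (ArtinB.σ (Fin.last m))) -
        (MvPolynomial.C z : SRing K) • DirectSum.lof (SRing K) ℕ (HAlg K q) m a)
  /-- `tr(a t'_n^k) = s_k tr(a)` for `a ∈ H_{1,n}(q)`, `n = m + 1`. -/
  | loop (m : ℕ) (a : HAlg K q m) (k : ℤ) : MarkovRel q z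
      (DirectSum.lof (SRing K) ℕ (HAlg K q) (m + 1)
          (HeckeB.incl _ _ m a * HeckeB.π _ _ _ (ArtinB.tt' (Fin.last (m + 1)) ^ k)) -
        sVar K k • DirectSum.lof (SRing K) ℕ (HAlg K q) m a)

/-- The module of values of the Markov trace: the `K[s_k]`-module generated by symbols `tr(a)`,
`a ∈ ⋃_n H_{1,n}(q)`, linear in `a`, modulo the rules of the Markov trace.  That there is exactly one
Markov trace with values in `K[s_k]` and `tr(1) = 1` says that this module is free with basis
`tr(1)`; so its elements are polynomials in the `s_k`, with `tr(1)` in the role of `1`. -/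
def TraceModule (q z : K) : Type _ :=
  (⨁ m, HAlg K q m) ⧸ Submodule.span (SRing K) {x | MarkovRel K q z x}

instance (q z : K) : AddCommGroup (TraceModule K q z) :=
  inferInstanceAs (AddCommGroup ((⨁ m, HAlg K q m) ⧸ Submodule.span (SRing K) _))

instance (q z : K) : Module (SRing K) (TraceModule K q z) :=
  inferInstanceAs (Module (SRing K) ((⨁ m, HAlg K q m) ⧸ Submodule.span (SRing K) _))

instance (q z : K) : Module K (TraceModule K q z) :=
  Module.compHom _ (algebraMap K (SRing K))

instance (q z : K) : IsScalarTower K (SRing K) (TraceModule K q z) :=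
  IsScalarTower.of_algebraMap_smul fun _ _ => rfl

variable {K}

/-- The Markov trace on `H_{1,m+1}(q)`. -/
def tr (q z : K) (m : ℕ) : HAlg K q m →ₗ[SRing K] TraceModule K q z :=
  (Submodule.mkQ (Submodule.span (SRing K) {x | MarkovRel K q z x})).comp (DirectSum.lof (SRing K) ℕ (HAlg K q) m)

/-- `λ = (z + 1 - q) / (q z)`. -/
def lam (q z : K) : K := (z + 1 - q) / (q * z)

/-- The invariant `X` of the closure of a mixed braid `α` with `n = m + 1` moving strands,
`[-(1 - λ q) / (√λ (1 - q))]^(n-1) (√λ)^e tr(π(α))`, where `r` is the chosen root `√λ` and `e` is the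
exponent sum of the `σ_i`'s in `α`. -/
def invX (q z r : K) {m : ℕ} (α : ArtinB m) : TraceModule K q z :=
  ((-((1 - lam q z * q) / (r * (1 - q)))) ^ m * r ^ (ArtinB.expSum α).toAdd) •
    tr q z m (HeckeB.π _ _ m α)

/-- The equations `X_α̂ = X_{sl_{±i}(α)^}`, for `α` in a given set of mixed braids, with the braid
band move of either sign performed on any moving strand of `α`; an equation is recorded by the
difference of its two sides. -/
def bbmEquations (q z r : K) (p : ℤ) (S : ∀ m, Set (ArtinB m)) : Set (TraceModule K q z) :=
  {e | ∃ (m : ℕ) (α : ArtinB m) (i : Fin (m + 1)) (ε : ℤˣ), α ∈ S m ∧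
    e = invX q z r α - invX q z r (ArtinB.sl p ε i α)}

/-- Two systems of equations are equivalent if every equation of either is a `K`-linear combination
of equations of the other. -/
def EquivSystems {q z : K} (E F : Set (TraceModule K q z)) : Prop :=
  Submodule.span K E = Submodule.span K F

end Trace

/-! ### The sets `L` and `Λ`, and braiding tails -/

/-- Exponents `(k_0, …, k_j)` of the elements of `L`: all of them nonzero, or the single exponent
`k_0 = 0`, which gives the unknot `t^0`. -/
def LExp {j : ℕ} (k : Fin (j + 1) → ℤ) : Prop := (∀ i, k i ≠ 0) ∨ j = 0

/-- Exponents of the elements of `Λ`: those of `L` that are in decreasing order. -/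
def LambdaExp {j : ℕ} (k : Fin (j + 1) → ℤ) : Prop := LExp k ∧ Antitone k

/-- The elements `t^{k_0} t_1^{k_1} ⋯ t_m^{k_m}` of `L` with `m + 1` moving strands. -/
def LSet (m : ℕ) : Set (ArtinB m) :=
  {α | ∃ k : Fin (m + 1) → ℤ, LExp k ∧ α = ArtinB.mono le_rfl k}

/-- The elements `t^{k_0} t_1^{k_1} ⋯ t_m^{k_m}` of `Λ` with `m + 1` moving strands. -/
def LambdaSet (m : ℕ) : Set (ArtinB m) :=
  {α | ∃ k : Fin (m + 1) → ℤ, LambdaExp k ∧ α = ArtinB.mono le_rfl k}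

/-- The elements `τ · w` with `m + 1` moving strands, where `τ ∈ Λ` and the braiding tail `w` is a
word in `σ_1^{±1}, …, σ_m^{±1}`. -/
def LambdaTailSet (m : ℕ) : Set (ArtinB m) :=
  {α | ∃ (j : ℕ) (h : j ≤ m) (k : Fin (j + 1) → ℤ),
    ∃ w ∈ Subgroup.closure (Set.range (ArtinB.σ : Fin m → ArtinB m)),
      LambdaExp k ∧ α = ArtinB.mono h k * w}

end

/-! ### Groups with generators of type B, indexed by natural numbers -/

/-! The equations of Λ already imply the equation of every braid band move on every mixed braid, so
every set of mixed braids containing Λ has the same system up to equivalence. Since X is invariant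
under conjugation, only moves on the first strand, the marked one, have to be considered
(`bbmDiff`).

Let W be the K-span of the equations of Λ, and argue by induction on the number of moving strands.
On mixed braids with M + 1 strands, the class φ of `bbmDiff` modulo W satisfies φ(xσ²y) = aφ(xσy) +
bφ(xy) with a = (q - 1)√λ and b = qλ, and it is unchanged under conjugation by those σ_i that do not
touch the marked strand. By induction it vanishes if the last strand is trivial or stabilized. It
also vanishes if the marked strand is trivial: there a times the equation is a combination of the
equations of both signs for a braid with one strand less (`bbmDiff_split`), and a is invertible in
K. Finally it vanishes on the elements of Λ, whichever strand is marked.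

These properties force φ = 0 (`IsMarkedFunctional.eq_zero`). Changing crossings to sort the
exponents leaves error terms of the same kind with the coefficient a, which Nakayama's lemma
absorbs. As q and z are algebraically independent, the specialization q = z = 1 yields a valuation
ring B of K in which a is a nonunit and b a unit. Fix d and let N be the B-span of the values
φ(t'_0^{k_0} ⋯ t'_M^{k_M}) with Σ|k_i| ≤ d. Then N is finitely generated, and by a spanning theorem
for Hecke algebras that keeps track of the number of loops (`IsTypeB.map_mem_stabSpan`) it contains
φ of every word with at most d letters t^{±1}. Modulo aN crossing changes are invisible: each t'_i
may be replaced by t_i, the exponents permuted and the marked strand moved, until one of the known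
zeros is reached. Hence N = aN, so N = 0. -/

/-- The relations of the Artin group of type B for elements `t, s 0, s 1, …` of a group, where the
braid relations are only required of the first `M` elements `s i`. -/
structure IsTypeB {G : Type*} [Group G] (M : ℕ) (t : G) (s : ℕ → G) : Prop where
  loop : s 0 * t * s 0 * t = t * s 0 * t * s 0
  comm : ∀ i, 0 < i → t * s i = s i * t
  braid : ∀ i, i + 1 < M → s i * s (i + 1) * s i = s (i + 1) * s i * s (i + 1)
  far : ∀ i j, i + 1 < j → s i * s j = s j * s i

/-- Words in `t^{±1}` and `s i^{±1}`, `i < j`, with at most `d` letters `t^{±1}`. -/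
inductive LoopWord {G : Type*} [Group G] (t : G) (s : ℕ → G) (j : ℕ) : ℕ → G → Prop
  | one (d : ℕ) : LoopWord t s j d 1
  | mul_s {d : ℕ} {α : G} (i : ℕ) (hi : i < j) (h : LoopWord t s j d α) :
      LoopWord t s j d (α * s i)
  | mul_s_inv {d : ℕ} {α : G} (i : ℕ) (hi : i < j) (h : LoopWord t s j d α) :
      LoopWord t s j d (α * (s i)⁻¹)
  | mul_t {d : ℕ} {α : G} (h : LoopWord t s j d α) : LoopWord t s j (d + 1) (α * t)
  | mul_t_inv {d : ℕ} {α : G} (h : LoopWord t s j d α) : LoopWord t s j (d + 1) (α * t⁻¹)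

/-- The loops `s_{i-1} ⋯ s_0 t s_0⁻¹ ⋯ s_{i-1}⁻¹`. -/
def loopConj {G : Type*} [Group G] (t : G) (s : ℕ → G) : ℕ → G
  | 0 => t
  | i + 1 => s i * loopConj t s i * (s i)⁻¹

/-- The loops `s_{i-1} ⋯ s_0 t s_0 ⋯ s_{i-1}`. -/
def loopSymm {G : Type*} [Group G] (t : G) (s : ℕ → G) : ℕ → G
  | 0 => t
  | i + 1 => s i * loopSymm t s i * s i

/-- The product `x_j^{k_0} x_{j+1}^{k_1} ⋯` for a list of exponents `k_0, k_1, …`. -/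
def zpowProd {G : Type*} [Group G] (x : ℕ → G) : ℕ → List ℤ → G
  | _, [] => 1
  | j, k :: l => x j ^ k * zpowProd x (j + 1) l

/-- The sum of the absolute values of a list of integers. -/
def absSum (l : List ℤ) : ℕ := (l.map Int.natAbs).sum

/-- The product `s_0 s_1 ⋯ s_{n-1}`. -/
def ascProd {G : Type*} [Group G] (s : ℕ → G) : ℕ → G
  | 0 => 1
  | n + 1 => ascProd s n * s n

/-- The product `s_{n-1} ⋯ s_1 s_0`. -/
def descProd {G : Type*} [Group G] (s : ℕ → G) : ℕ → G
  | 0 => 1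
  | n + 1 => s n * descProd s n

@[simp] theorem absSum_nil : absSum [] = 0 := rfl

@[simp] theorem absSum_cons (k : ℤ) (l : List ℤ) : absSum (k :: l) = k.natAbs + absSum l := rfl

@[simp] theorem absSum_append (l l' : List ℤ) : absSum (l ++ l') = absSum l + absSum l' := by
  simp [absSum]

theorem List.Perm.absSum_eq {l l' : List ℤ} (h : l.Perm l') : absSum l = absSum l' :=
  (h.map _).sum_eq

section Group

variable {G : Type*} [Group G] {t : G} {s : ℕ → G} {M : ℕ}

/-! ### Words with a bounded number of loops. -/

namespace LoopWord

theorem mono {j j' d d' : ℕ} {α : G} (h : LoopWord t s j d α) (hj : j ≤ j') (hd : d ≤ d') :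
    LoopWord t s j' d' α := by
  induction h generalizing d' with
  | one d => exact .one _
  | mul_s i hi _ ih => exact .mul_s i (hi.trans_le hj) (ih hd)
  | mul_s_inv i hi _ ih => exact .mul_s_inv i (hi.trans_le hj) (ih hd)
  | mul_t _ ih =>
    obtain ⟨e, rfl⟩ := Nat.exists_eq_add_of_le' (Nat.le_of_add_left_le hd)
    exact .mul_t (ih (by omega))
  | mul_t_inv _ ih =>
    obtain ⟨e, rfl⟩ := Nat.exists_eq_add_of_le' (Nat.le_of_add_left_le hd)
    exact .mul_t_inv (ih (by omega))

theorem mul {j d d' : ℕ} {α β : G} (h : LoopWord t s j d α) (h' : LoopWord t s j d' β) :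
    LoopWord t s j (d + d') (α * β) := by
  induction h' with
  | one e => simpa using h.mono le_rfl (by omega)
  | mul_s i hi _ ih => rw [← mul_assoc]; exact .mul_s i hi ih
  | mul_s_inv i hi _ ih => rw [← mul_assoc]; exact .mul_s_inv i hi ih
  | mul_t _ ih => rw [← mul_assoc, ← add_assoc]; exact .mul_t ih
  | mul_t_inv _ ih => rw [← mul_assoc, ← add_assoc]; exact .mul_t_inv ih

theorem of_s {j i : ℕ} (hi : i < j) : LoopWord t s j 0 (s i) := by
  simpa using LoopWord.mul_s (t := t) i hi (.one 0)

theorem of_s_inv {j i : ℕ} (hi : i < j) : LoopWord t s j 0 (s i)⁻¹ := by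
  simpa using LoopWord.mul_s_inv (t := t) i hi (.one 0)

theorem of_t {j : ℕ} : LoopWord t s j 1 t := by
  simpa using LoopWord.mul_t (t := t) (s := s) (j := j) (.one 0)

theorem of_t_inv {j : ℕ} : LoopWord t s j 1 t⁻¹ := by
  simpa using LoopWord.mul_t_inv (t := t) (s := s) (j := j) (.one 0)

theorem inv {j d : ℕ} {α : G} (h : LoopWord t s j d α) : LoopWord t s j d α⁻¹ := by
  induction h with
  | one e => simpa using .one e
  | mul_s i hi _ ih => rw [mul_inv_rev]; simpa using (of_s_inv hi).mul ih
  | mul_s_inv i hi _ ih => rw [mul_inv_rev, inv_inv]; simpa using (of_s hi).mul ih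
  | mul_t _ ih => rw [mul_inv_rev, add_comm]; exact of_t_inv.mul ih
  | mul_t_inv _ ih => rw [mul_inv_rev, inv_inv, add_comm]; exact of_t.mul ih

theorem zpow {j : ℕ} {α : G} (h : LoopWord t s j 1 α) (k : ℤ) :
    LoopWord t s j k.natAbs (α ^ k) := by
  have hn : ∀ n : ℕ, LoopWord t s j n (α ^ n) := fun n => by
    induction n with
    | zero => simpa using .one 0
    | succ n ih => rw [pow_succ]; exact ih.mul h
  obtain ⟨n, rfl | rfl⟩ := k.eq_nat_or_neg
  · simpa using hn n
  · simpa using (hn n).inv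

theorem of_loopConj {j i : ℕ} (hi : i ≤ j) : LoopWord t s j 1 (loopConj t s i) := by
  induction i with
  | zero => exact of_t
  | succ i ih => exact .mul_s_inv i hi (by simpa using (of_s hi).mul (ih (by omega)))

theorem of_loopSymm {j i : ℕ} (hi : i ≤ j) : LoopWord t s j 1 (loopSymm t s i) := by
  induction i with
  | zero => exact of_t
  | succ i ih => exact .mul_s i hi (by simpa using (of_s hi).mul (ih (by omega)))

theorem zpowProd {x : ℕ → G} {j i : ℕ} (l : List ℤ)
    (hx : ∀ n < i + l.length, LoopWord t s j 1 (x n)) :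
    LoopWord t s j (absSum l) (zpowProd x i l) := by
  induction l generalizing i with
  | nil => exact .one _
  | cons k l ih =>
    simp only [List.length_cons] at hx
    exact ((hx i (by omega)).zpow k).mul (ih fun n hn => hx n (by omega))

theorem exists_zpow {d : ℕ} {α : G} (h : LoopWord t s 0 d α) :
    ∃ k : ℤ, k.natAbs ≤ d ∧ α = t ^ k := by
  induction h with
  | one d => exact ⟨0, by simp⟩
  | mul_s i hi => omega
  | mul_s_inv i hi => omega
  | mul_t _ ih =>
    obtain ⟨k, hk, rfl⟩ := ih
    exact ⟨k + 1, by omega, (zpow_add_one _ _).symm⟩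
  | mul_t_inv _ ih =>
    obtain ⟨k, hk, rfl⟩ := ih
    exact ⟨k - 1, by omega, (zpow_sub_one _ _).symm⟩

/-- An element that commutes with all generators commutes with all words. -/
theorem commute {j d : ℕ} {α β : G} (h : LoopWord t s j d α) (ht : Commute t β)
    (hs : ∀ i < j, Commute (s i) β) : Commute α β := by
  induction h with
  | one d => exact Commute.one_left _
  | mul_s i hi _ ih => exact ih.mul_left (hs i hi)
  | mul_s_inv i hi _ ih => exact ih.mul_left (hs i hi).inv_left
  | mul_t _ ih => exact ih.mul_left ht
  | mul_t_inv _ ih => exact ih.mul_left ht.inv_left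

end LoopWord

theorem zpowProd_append (x : ℕ → G) (j : ℕ) (l l' : List ℤ) :
    zpowProd x j (l ++ l') = zpowProd x j l * zpowProd x (j + l.length) l' := by
  induction l generalizing j with
  | nil => simp [zpowProd]
  | cons k l ih => simp [zpowProd, ih, mul_assoc, add_comm, add_left_comm]

theorem zpowProd_commute {x : ℕ → G} {j : ℕ} {l : List ℤ} {β : G}
    (h : ∀ i, j ≤ i → i < j + l.length → Commute (x i) β) : Commute (zpowProd x j l) β := by
  induction l generalizing j with
  | nil => exact Commute.one_left _
  | cons k l ih =>
    simp only [List.length_cons] at h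
    exact ((h j le_rfl (by omega)).zpow_left k).mul_left
      (ih fun i hi hi' => h i (by omega) (by omega))

theorem loopConj_succ_zpow (i : ℕ) (k : ℤ) :
    loopConj t s (i + 1) ^ k = s i * loopConj t s i ^ k * (s i)⁻¹ := conj_zpow

/-! ### Commutation and conjugation of loops. -/

namespace IsTypeB

variable (hG : IsTypeB M t s)
include hG

theorem commute_s {i j : ℕ} (h : i + 1 < j ∨ j + 1 < i) : Commute (s i) (s j) :=
  h.elim (hG.far i j) fun h => (hG.far j i h).symm

theorem commute_word {j d i : ℕ} {α : G} (h : LoopWord t s j d α) (hi : j < i) :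
    Commute α (s i) :=
  h.commute (hG.comm i (by omega)) fun l hl => hG.commute_s (Or.inl (by omega))

theorem loopConj_commute_of_lt {j i : ℕ} (h : j < i) : Commute (loopConj t s j) (s i) :=
  hG.commute_word (LoopWord.of_loopConj le_rfl) h

theorem loopSymm_commute_of_lt {j i : ℕ} (h : j < i) : Commute (loopSymm t s j) (s i) :=
  hG.commute_word (LoopWord.of_loopSymm le_rfl) h

theorem braid_inv {i : ℕ} (h : i + 1 < M) :
    (s (i + 1))⁻¹ * s i * s (i + 1) = s i * s (i + 1) * (s i)⁻¹ := by
  rw [eq_mul_inv_iff_mul_eq, mul_assoc, mul_assoc, inv_mul_eq_iff_eq_mul, ← mul_assoc, hG.braid i h,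
    mul_assoc]

/-- All outer conjugating letters far from `s l` commute with it, which leaves the case `j = l + 2`.
There the braid relation carries `s l` through `s (l + 1) * s l` as `s (l + 1)`, which commutes with
the inner loop. -/
theorem loopConj_commute {j l : ℕ} (hl : l + 1 < j) (hj : j ≤ M) :
    Commute (loopConj t s j) (s l) := by
  induction j with
  | zero => omega
  | succ j ih =>
    rcases Nat.lt_or_ge (l + 1) j with h | h
    · exact ((hG.commute_s (Or.inr (by omega))).mul_left (ih h (by omega))).mul_left
        (hG.commute_s (Or.inr (by omega))).inv_left
    · obtain rfl : j = l + 1 := by omega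
      have hx := hG.loopConj_commute_of_lt (Nat.lt_succ_self l)
      have hb := hG.braid l (by omega)
      have e : (s l)⁻¹ * (s (l + 1))⁻¹ * s l = s (l + 1) * (s l)⁻¹ * (s (l + 1))⁻¹ := by
        rw [eq_mul_inv_iff_mul_eq, eq_mul_inv_iff_mul_eq]
        calc _ = (s l)⁻¹ * (s (l + 1))⁻¹ * (s l * s (l + 1) * s l) := by group
          _ = _ := by rw [hb]; group
      change s (l + 1) * (s l * loopConj t s l * (s l)⁻¹) * (s (l + 1))⁻¹ * s l =
        s l * (s (l + 1) * (s l * loopConj t s l * (s l)⁻¹) * (s (l + 1))⁻¹)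
      calc _ = s (l + 1) * s l * loopConj t s l * ((s l)⁻¹ * (s (l + 1))⁻¹ * s l) := by group
        _ = s (l + 1) * s l * (loopConj t s l * s (l + 1)) * (s l)⁻¹ * (s (l + 1))⁻¹ := by
          rw [e]; group
        _ = (s (l + 1) * s l * s (l + 1)) * loopConj t s l * (s l)⁻¹ * (s (l + 1))⁻¹ := by
          rw [hx.eq]; group
        _ = _ := by rw [← hb]; group

theorem loopSymm_commute {j l : ℕ} (hl : l + 1 < j) (hj : j ≤ M) :
    Commute (loopSymm t s j) (s l) := by
  induction j with
  | zero => omega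
  | succ j ih =>
    rcases Nat.lt_or_ge (l + 1) j with h | h
    · exact ((hG.commute_s (Or.inr (by omega))).mul_left (ih h (by omega))).mul_left
        (hG.commute_s (Or.inr (by omega)))
    · obtain rfl : j = l + 1 := by omega
      have hx := hG.loopSymm_commute_of_lt (Nat.lt_succ_self l)
      have hb := hG.braid l (by omega)
      change s (l + 1) * (s l * loopSymm t s l * s l) * s (l + 1) * s l =
        s l * (s (l + 1) * (s l * loopSymm t s l * s l) * s (l + 1))
      calc _ = s (l + 1) * s l * loopSymm t s l * (s l * s (l + 1) * s l) := by group
        _ = s (l + 1) * s l * (loopSymm t s l * s (l + 1)) * s l * s (l + 1) := by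
          rw [hb]; group
        _ = (s (l + 1) * s l * s (l + 1)) * loopSymm t s l * s l * s (l + 1) := by
          rw [hx.eq]; group
        _ = _ := by rw [← hb]; group

theorem loopSymm_commute_t (j : ℕ) : Commute (loopSymm t s j) t := by
  induction j with
  | zero => exact Commute.refl t
  | succ j ih =>
    rcases Nat.eq_zero_or_pos j with rfl | h
    · change s 0 * t * s 0 * t = t * (s 0 * t * s 0)
      rw [hG.loop]; group
    · have hc : Commute (s j) t := (hG.comm j h).symm
      exact (hc.mul_left ih).mul_left hc

theorem loopSymm_commute_succ {j : ℕ} (hj : j + 1 ≤ M) :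
    Commute (loopSymm t s j) (loopSymm t s (j + 1)) :=
  (LoopWord.of_loopSymm (le_refl j)).commute (hG.loopSymm_commute_t _).symm
    fun i hi => (hG.loopSymm_commute (by omega) hj).symm

/-- Conjugation by `s_0 ⋯ s_{n-1}` shifts the loops. -/
theorem ascProd_conj_loopConj {i n : ℕ} (hin : i < n) (hn : n ≤ M) :
    SemiconjBy (ascProd s n) (loopConj t s i) (loopConj t s (i + 1)) := by
  induction n with
  | zero => omega
  | succ n ih =>
    simp only [ascProd]
    rcases Nat.lt_or_ge i n with h | h
    · exact (ih h (by omega)).mul_left (hG.loopConj_commute_of_lt h).symm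
    · obtain rfl : i = n := by omega
      have h1 : ∀ l ≤ i, Commute (loopConj t s (i + 1)) (ascProd s l) := fun l hl => by
        induction l with
        | zero => exact Commute.one_right _
        | succ l ih' =>
          simp only [ascProd]
          exact (ih' (by omega)).mul_right (hG.loopConj_commute (by omega) hn)
      refine SemiconjBy.mul_left (h1 i le_rfl).symm ?_
      simp [SemiconjBy, loopConj]

/-- Conjugation by `s_0 ⋯ s_{n-1}` shifts the generators. -/
theorem ascProd_conj_s {i n : ℕ} (hin : i + 1 < n) (hn : n ≤ M) :
    SemiconjBy (ascProd s n) (s i) (s (i + 1)) := by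
  induction n with
  | zero => omega
  | succ n ih =>
    rcases Nat.lt_or_ge (i + 1) n with h | h
    · exact (ih h (by omega)).mul_left (hG.commute_s (Or.inr h))
    · obtain rfl : n = i + 1 := by omega
      have h1 : ∀ l ≤ i, Commute (s (i + 1)) (ascProd s l) := fun l hl => by
        induction l with
        | zero => exact Commute.one_right _
        | succ l ih' => exact (ih' (by omega)).mul_right (hG.commute_s (Or.inr (by omega)))
      change ascProd s i * s i * s (i + 1) * s i = s (i + 1) * (ascProd s i * s i * s (i + 1))
      calc _ = ascProd s i * (s i * s (i + 1) * s i) := by group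
        _ = (ascProd s i * s (i + 1)) * s i * s (i + 1) := by rw [hG.braid i (by omega)]; group
        _ = _ := by rw [← (h1 i le_rfl).eq]; group

theorem ascProd_conj_zpowProd {n j : ℕ} (hn : n ≤ M) (l : List ℤ) (h : j + l.length ≤ n) :
    SemiconjBy (ascProd s n) (zpowProd (loopConj t s) j l)
      (zpowProd (loopConj t s) (j + 1) l) := by
  induction l generalizing j with
  | nil => simp [zpowProd]
  | cons k l ih =>
    simp only [List.length_cons] at h
    exact ((hG.ascProd_conj_loopConj (by omega) hn).zpow_right k).mul_right (ih (by omega))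

end IsTypeB

end Group

/-! ### Spanning sets of generalized Hecke algebras -/

/-- The span of the images of the elements `α s_j β` and `α t'_{j+1}^k` with `α`, `β` words in `t` and
`s i`, `i < j`, where altogether there are at most `d` loops. -/
def stabSpan (O : Type*) {G A : Type*} [Group G] [CommRing O] [Ring A] [Algebra O A]
    (t : G) (s : ℕ → G) (ρ : G →* A) (j d : ℕ) : Submodule O A :=
  Submodule.span O ({x | ∃ d₁ d₂ α β, LoopWord t s j d₁ α ∧ LoopWord t s j d₂ β ∧ d₁ + d₂ ≤ d ∧
      x = ρ (α * s j * β)} ∪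
    {x | ∃ d₁ α, ∃ k : ℤ, LoopWord t s j d₁ α ∧ d₁ + k.natAbs ≤ d ∧
      x = ρ (α * loopConj t s (j + 1) ^ k)})

namespace IsTypeB

variable {G : Type*} [Group G] {t : G} {s : ℕ → G} {M : ℕ} (hG : IsTypeB M t s)
  {O A : Type*} [CommRing O] [Ring A] [Algebra O A] {ρ : G →* A} {a b : O}

theorem stabSpan_of_stab {j d d₁ d₂ : ℕ} {α β : G} (hα : LoopWord t s j d₁ α)
    (hβ : LoopWord t s j d₂ β) (h : d₁ + d₂ ≤ d) : ρ (α * s j * β) ∈ stabSpan O t s ρ j d :=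
  Submodule.subset_span (Or.inl ⟨d₁, d₂, α, β, hα, hβ, h, rfl⟩)

theorem stabSpan_of_loop {j d d₁ : ℕ} {α : G} (k : ℤ) (hα : LoopWord t s j d₁ α)
    (h : d₁ + k.natAbs ≤ d) : ρ (α * loopConj t s (j + 1) ^ k) ∈ stabSpan O t s ρ j d :=
  Submodule.subset_span (Or.inr ⟨d₁, α, k, hα, h, rfl⟩)

theorem stabSpan_of_word {j d : ℕ} {α : G} (hα : LoopWord t s j d α) :
    ρ α ∈ stabSpan O t s ρ j d := by
  simpa using stabSpan_of_loop (O := O) (ρ := ρ) 0 hα (by simp)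

theorem stabSpan_mono {j d d' : ℕ} (h : d ≤ d') : stabSpan O t s ρ j d ≤ stabSpan O t s ρ j d' := by
  refine Submodule.span_mono (Set.union_subset_union ?_ ?_)
  · rintro _ ⟨d₁, d₂, α, β, hα, hβ, hd, rfl⟩
    exact ⟨d₁, d₂, α, β, hα, hβ, hd.trans h, rfl⟩
  · rintro _ ⟨d₁, α, k, hα, hd, rfl⟩
    exact ⟨d₁, α, k, hα, hd.trans h, rfl⟩

theorem stabSpan_mul_left {j d d' : ℕ} {γ : G} (hγ : LoopWord t s j d' γ) {x : A}
    (hx : x ∈ stabSpan O t s ρ j d) : ρ γ * x ∈ stabSpan O t s ρ j (d' + d) := by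
  have h : stabSpan O t s ρ j d ≤
      (stabSpan O t s ρ j (d' + d)).comap (LinearMap.mulLeft O (ρ γ)) := by
    refine Submodule.span_le.2 (Set.union_subset ?_ ?_)
    · rintro _ ⟨d₁, d₂, α, β, hα, hβ, hd, rfl⟩
      rw [SetLike.mem_coe, Submodule.mem_comap, LinearMap.mulLeft_apply, ← map_mul, ← mul_assoc, ← mul_assoc]
      exact stabSpan_of_stab (hγ.mul hα) hβ (by omega)
    · rintro _ ⟨d₁, α, k, hα, hd, rfl⟩
      rw [SetLike.mem_coe, Submodule.mem_comap, LinearMap.mulLeft_apply, ← map_mul, ← mul_assoc]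
      exact stabSpan_of_loop (O := O) k (hγ.mul hα) (by omega)
  exact h hx

/-- To see that `stabSpan` is mapped to a submodule by a right multiplication, it suffices to look at
its generators. -/
theorem stabSpan_mul_right {j d : ℕ} {γ : A} {N : Submodule O A}
    (h1 : ∀ d₁ d₂ α β, LoopWord t s j d₁ α → LoopWord t s j d₂ β → d₁ + d₂ ≤ d →
      ρ (α * s j * β) * γ ∈ N)
    (h2 : ∀ d₁ α, ∀ k : ℤ, LoopWord t s j d₁ α → d₁ + k.natAbs ≤ d →
      ρ (α * loopConj t s (j + 1) ^ k) * γ ∈ N) {x : A}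
    (hx : x ∈ stabSpan O t s ρ j d) : x * γ ∈ N := by
  have h : stabSpan O t s ρ j d ≤ N.comap (LinearMap.mulRight O γ) := by
    refine Submodule.span_le.2 (Set.union_subset ?_ ?_)
    · rintro _ ⟨d₁, d₂, α, β, hα, hβ, hd, rfl⟩
      exact h1 _ _ _ _ hα hβ hd
    · rintro _ ⟨d₁, α, k, hα, hd, rfl⟩
      exact h2 _ _ _ hα hd
  exact h hx

variable (hb : IsUnit b) (hq : ∀ i < M, ρ (s i) * ρ (s i) = a • ρ (s i) + b • 1)

include hb hq in
theorem smul_map_s_inv {i : ℕ} (hi : i < M) : ρ (s i)⁻¹ = Ring.inverse b • (ρ (s i) - a • 1) := by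
  have h1 : b • ρ (s i)⁻¹ = ρ (s i) - a • 1 := by
    have h2 : ρ (s i) * ρ (s i)⁻¹ = 1 := by rw [← map_mul, mul_inv_cancel, map_one]
    have h3 := congrArg (· * ρ (s i)⁻¹) (hq i hi)
    simp only [mul_assoc, h2, add_mul, smul_mul_assoc, mul_one, one_mul] at h3
    rw [h3, add_sub_cancel_left]
  rw [← h1, smul_smul, Ring.inverse_mul_cancel b hb, one_smul]

-- By the quadratic relation, with `b` a unit, the inverse of a generator is a combination of the
-- generator and 1. Inverse letters therefore need no separate treatment in the spanning arguments.
include hb hq in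
theorem mul_map_s_inv_mem {N : Submodule O A} {i : ℕ} (hi : i < M) {x : A} (h : x * ρ (s i) ∈ N)
    (hx : x ∈ N) : x * ρ (s i)⁻¹ ∈ N := by
  rw [smul_map_s_inv hb hq hi, mul_smul_comm, mul_sub, mul_smul_comm, mul_one]
  exact N.smul_mem _ (N.sub_mem h (N.smul_mem _ hx))

include hG hb hq in
/-- The commutator of `t` with the powers of `s_0 t s_0⁻¹`, written without denominators. -/
theorem loop_commutator (hM : 0 < M) (k : ℤ) :
    ρ (s 0) * ρ (t ^ k) * ρ (s 0) * ρ t + a • (ρ t * ρ (s 0) * ρ (t ^ k)) =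
      ρ t * ρ (s 0) * ρ (t ^ k) * ρ (s 0) + a • (ρ (t ^ k) * ρ (s 0) * ρ t) := by
  set S := ρ (s 0)
  set T := ρ t
  -- `y` is invertible and commutes with `t`, and `b • (T * S) = S * y - a • y`. Multiplying by `y`
  -- thus shifts the exponent of `t` by one, which permits an induction on `k` in both directions.
  set y := ρ (s 0 * t * s 0) with hy
  have hySTS : y = S * T * S := by simp [hy, S, T]
  have hyinv : y * ρ (s 0 * t * s 0)⁻¹ = 1 := by rw [← map_mul, mul_inv_cancel, map_one]
  have hSS : S * S = a • S + b • 1 := hq 0 hM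
  have hyT : y * T = T * y := by
    rw [← map_mul, ← map_mul, hG.loop]
    congr 1
    group
  have hSy : S * y = a • y + b • (T * S) := by
    rw [hySTS, ← mul_assoc, ← mul_assoc, hSS]
    simp [add_mul, mul_assoc]
  have hyP : ∀ k : ℤ, y * ρ (t ^ k) = ρ (t ^ k) * y := fun k => by
    have : Commute (s 0 * t * s 0) t := by
      change s 0 * t * s 0 * t = t * (s 0 * t * s 0)
      rw [hG.loop]; group
    rw [← map_mul, ← map_mul, (this.zpow_right k).eq]
  have hP1 : ∀ k : ℤ, ρ (t ^ (k + 1)) = ρ (t ^ k) * T := fun k => by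
    rw [← map_mul, zpow_add_one]
  -- The identity for `k + 1` is equivalent to the one for `k`.
  have step : ∀ k : ℤ, b • (S * ρ (t ^ (k + 1)) * S * T + a • (T * S * ρ (t ^ (k + 1))) -
        (T * S * ρ (t ^ (k + 1)) * S + a • (ρ (t ^ (k + 1)) * S * T))) =
      (S * ρ (t ^ k) * S * T + a • (T * S * ρ (t ^ k)) -
        (T * S * ρ (t ^ k) * S + a • (ρ (t ^ k) * S * T))) * y := by
    intro k
    have hyP := hyP k
    rw [hP1]
    generalize ρ (t ^ k) = P at hyP ⊢
    have e1 : b • (T * S) = S * y - a • y := by rw [hSy, add_sub_cancel_left]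
    have f1 : b • (S * (P * T) * S * T) = (S * P * S * T - a • (S * P * T)) * y :=
      calc _ = S * P * (b • (T * S)) * T := by simp [mul_assoc]
        _ = S * P * S * (y * T) - a • (S * P * (y * T)) := by
          rw [e1]; simp [mul_sub, sub_mul, mul_assoc]
        _ = _ := by rw [hyT]; simp [sub_mul, mul_assoc]
    have f2 : b • (T * S * (P * T)) = (S * P * T - a • (P * T)) * y :=
      calc _ = b • (T * S) * (P * T) := by simp [mul_assoc]
        _ = S * (y * P) * T - a • ((y * P) * T) := by
          rw [e1]; simp [sub_mul, mul_assoc]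
        _ = S * P * (y * T) - a • (P * (y * T)) := by rw [hyP]; simp [mul_assoc]
        _ = _ := by rw [hyT]; simp [sub_mul, mul_assoc]
    have f3 : b • (T * S * (P * T) * S) = (T * S * P * S - a • (T * S * P)) * y :=
      calc _ = T * S * P * (b • (T * S)) := by simp [mul_assoc]
        _ = _ := by rw [e1]; simp [mul_sub, sub_mul, mul_assoc]
    have f4 : b • (P * T * S * T) = (P * S * T - a • (P * T)) * y :=
      calc _ = P * (b • (T * S)) * T := by simp [mul_assoc]
        _ = P * S * (y * T) - a • (P * (y * T)) := by
          rw [e1]; simp [mul_sub, sub_mul, mul_assoc]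
        _ = _ := by rw [hyT]; simp [sub_mul, mul_assoc]
    rw [smul_sub, smul_add, smul_add, smul_comm b a, smul_comm b a, f1, f2, f3, f4]
    simp only [sub_mul, add_mul, smul_mul_assoc]
    module
  rw [← sub_eq_zero]
  induction k using Int.induction_on with
  | zero =>
    rw [zpow_zero, map_one, mul_one, hSS, mul_one, mul_assoc T, hSS]
    simp only [add_mul, mul_add, smul_mul_assoc, mul_smul_comm, one_mul, mul_one]
    abel
  | succ n ih =>
    have := step n
    rw [ih, zero_mul] at this
    exact hb.smul_eq_zero.1 this
  | pred n ih =>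
    have := step (-n - 1)
    rw [sub_add_cancel, ih, smul_zero] at this
    rw [← mul_one (_ - _), ← hyinv, ← mul_assoc, ← this, zero_mul]

-- Pulling the left `s j` past `α` turns the loop on strand `j` into one on strand `j + 1`, followed
-- by `s j * s j`. The quadratic relation leaves one term of each type of the spanning set.
include hq in
theorem stabSpan_conj_loop {j d d₁ : ℕ} {α : G} (k : ℤ) (hj : j < M) (hα : LoopWord t s j d₁ α)
    (hc : Commute α (s j)) (h : d₁ + k.natAbs ≤ d) :
    ρ (s j * (α * loopConj t s j ^ k) * s j) ∈ stabSpan O t s ρ j d := by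
  have h1 : s j * (α * loopConj t s j ^ k) * s j =
      α * loopConj t s (j + 1) ^ k * (s j * s j) := by
    rw [loopConj_succ_zpow, ← mul_assoc, ← hc.eq]; group
  have h2 : α * loopConj t s (j + 1) ^ k * s j = α * s j * loopConj t s j ^ k := by
    rw [loopConj_succ_zpow]; group
  rw [h1, map_mul, map_mul ρ (s j), hq j hj, mul_add, mul_smul_comm, mul_smul_comm, mul_one,
    ← map_mul, h2]
  exact Submodule.add_mem _
    (Submodule.smul_mem _ _ (stabSpan_of_stab hα ((LoopWord.of_loopConj le_rfl).zpow k) h))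
    (Submodule.smul_mem _ _ (stabSpan_of_loop k hα h))

include hG hq in
/-- Conjugates by the next generator, as long as the spanning theorem is known for the words that are
conjugated. -/
theorem stabSpan_conj_word {j d : ℕ} {β : G} (hj : j < M) (hβ : LoopWord t s j d β)
    (ih : ∀ i d α, j = i + 1 → LoopWord t s (i + 1) d α → ρ α ∈ stabSpan O t s ρ i d) :
    ρ (s j * β * s j) ∈ stabSpan O t s ρ j d := by
  cases j with
  | zero =>
    obtain ⟨k, hk, rfl⟩ := hβ.exists_zpow
    simpa [loopConj] using
      stabSpan_conj_loop (t := t) hq k hj (.one 0) (Commute.one_left _) (by simpa using hk)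
  | succ i =>
    rw [map_mul]
    have h : ρ (s (i + 1)) * ρ β * ρ (s (i + 1)) ∈ stabSpan O t s ρ (i + 1) d := by
      have h' : stabSpan O t s ρ i d ≤ (stabSpan O t s ρ (i + 1) d).comap
          (LinearMap.mulLeft O (ρ (s (i + 1))) ∘ₗ LinearMap.mulRight O (ρ (s (i + 1)))) := by
        refine Submodule.span_le.2 (Set.union_subset ?_ ?_)
        · rintro _ ⟨d₁, d₂, α, β, hα, hβ, hd, rfl⟩
          -- `α` and `β` lie on lower strands and commute with `s (i + 1)`, so the braid relation
          -- reduces the two letters `s (i + 1)` to one.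
          have e : s (i + 1) * (α * s i * β * s (i + 1)) = α * s i * s (i + 1) * (s i * β) := by
            have h1 := (hG.commute_word hα (Nat.lt_succ_self i)).eq
            have h2 := (hG.commute_word hβ (Nat.lt_succ_self i)).eq
            calc _ = (s (i + 1) * α) * s i * (β * s (i + 1)) := by group
              _ = α * (s (i + 1) * s i * s (i + 1)) * β := by rw [← h1, h2]; group
              _ = _ := by rw [← hG.braid i hj]; group
          simp only [SetLike.mem_coe, Submodule.mem_comap, LinearMap.comp_apply,
            LinearMap.mulLeft_apply, LinearMap.mulRight_apply, ← map_mul]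
          rw [e]
          refine stabSpan_of_stab (d₁ := d₁) (d₂ := d₂) ?_ ?_ hd
          · exact .mul_s i (Nat.lt_succ_self i) (hα.mono (Nat.le_succ i) le_rfl)
          · simpa using (LoopWord.of_s (Nat.lt_succ_self i)).mul (hβ.mono (Nat.le_succ i) le_rfl)
        · rintro _ ⟨d₁, α, k, hα, hd, rfl⟩
          simp only [SetLike.mem_coe, Submodule.mem_comap, LinearMap.comp_apply,
            LinearMap.mulLeft_apply, LinearMap.mulRight_apply, ← map_mul]
          rw [← mul_assoc]
          exact stabSpan_conj_loop hq k hj (hα.mono (Nat.le_succ i) le_rfl)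
            (hG.commute_word hα (Nat.lt_succ_self i)) hd
      have := h' (ih i d β rfl hβ)
      simpa [mul_assoc] using this
    simpa using h

section Span

include hG hb hq

theorem stabSpan_conj_inv_word {j d : ℕ} {β : G} (hj : j < M) (hβ : LoopWord t s j d β)
    (ih : ∀ i d α, j = i + 1 → LoopWord t s (i + 1) d α → ρ α ∈ stabSpan O t s ρ i d) :
    ρ (s j * β * (s j)⁻¹) ∈ stabSpan O t s ρ j d := by
  rw [map_mul]
  refine mul_map_s_inv_mem hb hq hj ?_ ?_
  · rw [← map_mul]
    exact hG.stabSpan_conj_word hq hj hβ ih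
  · simpa using stabSpan_of_stab (O := O) (ρ := ρ) (.one 0) hβ (by simp)

/-- This is the only place where a loop on the last strand and `t` fail to commute in an essential
way. By `loop_commutator` their commutator consists of terms with a single letter `s 0` and no more
than `k.natAbs + 1` loops; conjugating the identity by `t` gives the case of `t⁻¹`. -/
theorem stabSpan_first_loop {d d₁ : ℕ} {α : G} (k : ℤ) (hM : 0 < M) (hα : LoopWord t s 0 d₁ α)
    (hd : d₁ + k.natAbs ≤ d) :
    ρ (α * loopConj t s 1 ^ k * t) ∈ stabSpan O t s ρ 0 (d + 1) ∧
      ρ (α * loopConj t s 1 ^ k * t⁻¹) ∈ stabSpan O t s ρ 0 (d + 1) := by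
  have hinv := smul_map_s_inv hb hq hM
  have hL : ρ (loopConj t s 1 ^ k) =
      Ring.inverse b • (ρ (s 0) * ρ (t ^ k) * ρ (s 0) - a • (ρ (s 0) * ρ (t ^ k))) := by
    rw [loopConj_succ_zpow, map_mul, hinv, mul_smul_comm, mul_sub, mul_smul_comm, mul_one, map_mul]
    rfl
  have hc := hG.loop_commutator hb hq hM k
  -- The commutator of `t` with `t'_1^k`.
  have key : ρ (loopConj t s 1 ^ k) * ρ t = ρ t * ρ (loopConj t s 1 ^ k) + Ring.inverse b •
      (a • (ρ (t ^ k) * ρ (s 0) * ρ t) - a • (ρ (s 0) * ρ (t ^ k) * ρ t)) := by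
    rw [hL, smul_mul_assoc, mul_smul_comm, ← smul_add]
    congr 1
    simp only [mul_sub, sub_mul, smul_mul_assoc, mul_smul_comm, ← mul_assoc]
    rw [eq_sub_of_add_eq hc]
    abel
  have htt : ρ t * ρ t⁻¹ = 1 := by rw [← map_mul, mul_inv_cancel, map_one]
  have htt' : ρ t⁻¹ * ρ t = 1 := by rw [← map_mul, inv_mul_cancel, map_one]
  have key' : ρ (loopConj t s 1 ^ k) * ρ t⁻¹ = ρ t⁻¹ * ρ (loopConj t s 1 ^ k) - Ring.inverse b •
      (a • (ρ t⁻¹ * ρ (t ^ k) * ρ (s 0)) - a • (ρ t⁻¹ * ρ (s 0) * ρ (t ^ k))) := by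
    have := congrArg (fun x => ρ t⁻¹ * x * ρ t⁻¹) key
    simp only [mul_add, add_mul, mul_sub, sub_mul, smul_mul_assoc, mul_smul_comm, mul_assoc,
      htt, mul_one] at this
    rw [← mul_assoc (ρ t⁻¹) (ρ t), htt', one_mul] at this
    rw [this]
    simp only [mul_assoc]
    abel
  have hk : LoopWord t s 0 k.natAbs (t ^ k) := LoopWord.of_t.zpow k
  have h1 : ∀ {d₁ d₂ : ℕ} {α β : G}, LoopWord t s 0 d₁ α → LoopWord t s 0 d₂ β →
      d₁ + d₂ ≤ d + 1 → ρ α * ρ (s 0) * ρ β ∈ stabSpan O t s ρ 0 (d + 1) := fun hα hβ h => by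
    rw [← map_mul, ← map_mul]
    exact stabSpan_of_stab hα hβ h
  constructor
  · rw [mul_assoc, map_mul, map_mul, key, mul_add, mul_smul_comm, mul_sub, mul_smul_comm,
      mul_smul_comm]
    refine Submodule.add_mem _ ?_ (Submodule.smul_mem _ _ (Submodule.sub_mem _
      (Submodule.smul_mem _ _ ?_) (Submodule.smul_mem _ _ ?_)))
    · rw [← mul_assoc, ← map_mul, ← map_mul]
      exact stabSpan_of_loop k hα.mul_t (by omega)
    · simpa [mul_assoc] using h1 (hα.mul hk) LoopWord.of_t (by omega)
    · simpa [mul_assoc] using h1 hα (hk.mul LoopWord.of_t) (by omega)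
  · rw [mul_assoc, map_mul, map_mul, key', mul_sub, mul_smul_comm, mul_sub, mul_smul_comm,
      mul_smul_comm]
    refine Submodule.sub_mem _ ?_ (Submodule.smul_mem _ _ (Submodule.sub_mem _
      (Submodule.smul_mem _ _ ?_) (Submodule.smul_mem _ _ ?_)))
    · rw [← mul_assoc, ← map_mul, ← map_mul]
      exact stabSpan_of_loop k hα.mul_t_inv (by omega)
    · simpa [mul_assoc] using h1 (hα.mul_t_inv.mul hk) (.one 0) (by omega)
    · simpa [mul_assoc] using h1 hα.mul_t_inv hk (by omega)

/-- The loops on the last strand are moved past `t`. -/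
theorem stabSpan_loop_mul_t {j d d₁ : ℕ} {α : G} (k : ℤ) (hj : j < M) (hα : LoopWord t s j d₁ α)
    (hd : d₁ + k.natAbs ≤ d)
    (ih : ∀ i d α, j = i + 1 → LoopWord t s (i + 1) d α → ρ α ∈ stabSpan O t s ρ i d) :
    ρ (α * loopConj t s (j + 1) ^ k * t) ∈ stabSpan O t s ρ j (d + 1) ∧
      ρ (α * loopConj t s (j + 1) ^ k * t⁻¹) ∈ stabSpan O t s ρ j (d + 1) := by
  rcases Nat.eq_zero_or_pos j with rfl | h
  · exact hG.stabSpan_first_loop hb hq k hj hα hd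
  have hc : Commute (s j) t := (hG.comm j h).symm
  have hw := (LoopWord.of_loopConj (t := t) (s := s) (le_refl j)).zpow k
  have h1 : ∀ u : G, Commute (s j) u → α * loopConj t s (j + 1) ^ k * u =
      α * (s j * (loopConj t s j ^ k * u) * (s j)⁻¹) := fun u hu => by
    rw [loopConj_succ_zpow, mul_assoc α, mul_assoc _ (s j)⁻¹, hu.inv_left.eq]; group
  rw [h1 t hc, h1 t⁻¹ hc.inv_right, map_mul ρ α, map_mul ρ α]
  have hd' : d₁ + (k.natAbs + 1) ≤ d + 1 := by omega
  exact ⟨stabSpan_mono hd' (stabSpan_mul_left hα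
      (hG.stabSpan_conj_inv_word hb hq hj hw.mul_t ih)),
    stabSpan_mono hd' (stabSpan_mul_left hα
      (hG.stabSpan_conj_inv_word hb hq hj hw.mul_t_inv ih))⟩

/-- It suffices that right multiplication by a letter preserves the span, at the cost of one loop
for `t^{±1}`. The critical products are `α s_j β s_j`, where the spanning theorem one strand lower
is applied to `β`, and `α t'_{j+1}^k t^{±1}`. -/
theorem map_mem_stabSpan_of_prev {j d : ℕ} {α : G} (hj : j < M) (hα : LoopWord t s (j + 1) d α)
    (ih : ∀ i d α, j = i + 1 → LoopWord t s (i + 1) d α → ρ α ∈ stabSpan O t s ρ i d) :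
    ρ α ∈ stabSpan O t s ρ j d := by
  have mul_s : ∀ {d : ℕ} {x : A} (i : ℕ), i < j + 1 → x ∈ stabSpan O t s ρ j d →
      x * ρ (s i) ∈ stabSpan O t s ρ j d := by
    intro d x i hi hx
    refine stabSpan_mul_right ?_ ?_ hx
    · intro d₁ d₂ α β hα hβ hd
      rw [← map_mul]
      rcases Nat.lt_succ_iff_lt_or_eq.1 hi with h | rfl
      · rw [mul_assoc]
        exact stabSpan_of_stab hα (.mul_s i h hβ) hd
      · rw [mul_assoc, mul_assoc, ← mul_assoc (s i), map_mul]
        exact stabSpan_mono hd (stabSpan_mul_left hα (hG.stabSpan_conj_word hq hj hβ ih))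
    · intro d₁ α k hα hd
      rw [← map_mul]
      rcases Nat.lt_succ_iff_lt_or_eq.1 hi with h | rfl
      · rw [mul_assoc, ((hG.loopConj_commute (by omega) hj).zpow_left k).eq, ← mul_assoc]
        exact stabSpan_of_loop k (.mul_s i h hα) hd
      · rw [loopConj_succ_zpow, mul_assoc, inv_mul_cancel_right, ← mul_assoc]
        exact stabSpan_of_stab hα ((LoopWord.of_loopConj le_rfl).zpow k) hd
  induction hα with
  | one d => exact stabSpan_of_word (.one d)
  | mul_s i hi _ ih' => rw [map_mul]; exact mul_s i hi ih'
  | mul_s_inv i hi _ ih' =>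
    rw [map_mul]
    exact mul_map_s_inv_mem hb hq (by omega) (mul_s i hi ih') ih'
  | mul_t _ ih' =>
    rw [map_mul]
    refine stabSpan_mul_right ?_ ?_ ih'
    · intro d₁ d₂ α β hα hβ hd
      rw [← map_mul, mul_assoc]
      exact stabSpan_of_stab hα hβ.mul_t (by omega)
    · intro d₁ α k hα hd
      rw [← map_mul]
      exact (hG.stabSpan_loop_mul_t hb hq k hj hα hd ih).1
  | mul_t_inv _ ih' =>
    rw [map_mul]
    refine stabSpan_mul_right ?_ ?_ ih'
    · intro d₁ d₂ α β hα hβ hd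
      rw [← map_mul, mul_assoc]
      exact stabSpan_of_stab hα hβ.mul_t_inv (by omega)
    · intro d₁ α k hα hd
      rw [← map_mul]
      exact (hG.stabSpan_loop_mul_t hb hq k hj hα hd ih).2

/-- The spanning theorem: every word in `t` and `s i`, `i ≤ j`, is a linear combination of elements
`α s_j β` and `α t'_{j+1}^k`, where `α` and `β` are words in `t` and `s i`, `i < j`. -/
theorem map_mem_stabSpan {j d : ℕ} {α : G} (hj : j < M) (hα : LoopWord t s (j + 1) d α) :
    ρ α ∈ stabSpan O t s ρ j d := by
  induction j generalizing d α with
  | zero => exact hG.map_mem_stabSpan_of_prev hb hq hj hα fun i _ _ h => by omega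
  | succ j ihj =>
    refine hG.map_mem_stabSpan_of_prev hb hq hj hα fun i d α h hα => ?_
    obtain rfl : j = i := by omega
    exact ihj (by omega) hα

end Span

end IsTypeB

/-! ### Functionals on mixed braids with a marked strand -/

/-- The module of the functions on a group that satisfy the quadratic relations for `s i`, `i < M`. -/
def heckeFunctions {O G : Type*} [CommRing O] [Group G] (a b : O) (M : ℕ) (s : ℕ → G)
    (Q : Type*) [AddCommGroup Q] [Module O Q] : Submodule O (G → Q) where
  carrier := {ψ | ∀ x y, ∀ i < M, ψ (x * (s i * s i) * y) = a • ψ (x * s i * y) + b • ψ (x * y)}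
  add_mem' {ψ χ} h h' x y i hi := by
    simp only [Pi.add_apply, h x y i hi, h' x y i hi, smul_add]; abel
  zero_mem' x y i hi := by simp
  smul_mem' c ψ h x y i hi := by
    simp only [Pi.smul_apply, h x y i hi, smul_add, smul_comm c]

/-- The action of the group on functions by right translation. -/
def heckeFunctionsAction {O G : Type*} [CommRing O] [Group G] (a b : O) (M : ℕ) (s : ℕ → G)
    (Q : Type*) [AddCommGroup Q] [Module O Q] :
    G →* Module.End O (heckeFunctions a b M s Q) where
  toFun g :=
    { toFun := fun ψ => ⟨fun x => ψ.1 (x * g), fun x y i hi => by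
        simpa [mul_assoc] using ψ.2 x (y * g) i hi⟩
      map_add' := fun _ _ => rfl
      map_smul' := fun _ _ => rfl }
  map_one' := by ext ψ x; simp
  map_mul' g h := by ext ψ x; simp [mul_assoc]

theorem heckeFunctionsAction_quad {O G : Type*} [CommRing O] [Group G] (a b : O) (M : ℕ)
    (s : ℕ → G) (Q : Type*) [AddCommGroup Q] [Module O Q] (i : ℕ) (hi : i < M) :
    heckeFunctionsAction a b M s Q (s i) * heckeFunctionsAction a b M s Q (s i) =
      a • heckeFunctionsAction a b M s Q (s i) + b • 1 := by
  ext ψ x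
  simpa [heckeFunctionsAction, mul_assoc] using ψ.2 x 1 i hi

/-- To evaluate a Hecke function on a word modulo a submodule, it suffices to evaluate it on the
elements of the spanning set. -/
theorem IsTypeB.hecke_mem_of_stab_loop {G : Type*} [Group G] {t : G} {s : ℕ → G} {M : ℕ}
    (hG : IsTypeB M t s) {O Q : Type*} [CommRing O] [AddCommGroup Q] [Module O Q] {a b : O}
    (hb : IsUnit b) {ψ : G → Q} (hψ : ψ ∈ heckeFunctions a b M s Q) {j d : ℕ} (hj : j < M)
    (N : Submodule O Q)
    (h1 : ∀ d₁ d₂ α β, LoopWord t s j d₁ α → LoopWord t s j d₂ β → d₁ + d₂ ≤ d →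
      ψ (α * s j * β) ∈ N)
    (h2 : ∀ d₁ α, ∀ k : ℤ, LoopWord t s j d₁ α → d₁ + k.natAbs ≤ d →
      ψ (α * loopConj t s (j + 1) ^ k) ∈ N) {α : G} (hα : LoopWord t s (j + 1) d α) : ψ α ∈ N := by
  -- The spanning theorem concerns representations, whereas `ψ` is only a function. The
  -- representation is right translation on Hecke functions; evaluating the translate of `ψ` at 1
  -- recovers `ψ g`.
  let ev : Module.End O (heckeFunctions a b M s Q) →ₗ[O] Q :=
    { toFun := fun T => (T ⟨ψ, hψ⟩).1 1
      map_add' := fun _ _ => rfl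
      map_smul' := fun _ _ => rfl }
  have hev : ∀ g, ev (heckeFunctionsAction a b M s Q g) = ψ g := fun g => by
    simp [ev, heckeFunctionsAction]
  have h := hG.map_mem_stabSpan (A := Module.End O (heckeFunctions a b M s Q))
    (ρ := heckeFunctionsAction a b M s Q) (a := a) hb
    (heckeFunctionsAction_quad a b M s Q) hj hα
  have hle : stabSpan O (A := Module.End O (heckeFunctions a b M s Q)) t s
      (heckeFunctionsAction a b M s Q) j d ≤ N.comap ev := by
    refine Submodule.span_le.2 (Set.union_subset ?_ ?_)
    · rintro _ ⟨d₁, d₂, α, β, hα, hβ, hd, rfl⟩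
      simpa only [SetLike.mem_coe, Submodule.mem_comap, hev] using h1 _ _ _ _ hα hβ hd
    · rintro _ ⟨d₁, α, k, hα, hd, rfl⟩
      simpa only [SetLike.mem_coe, Submodule.mem_comap, hev] using h2 _ _ _ hα hd
  simpa only [Submodule.mem_comap, hev] using hle h

/-- The properties of the functional on mixed braids with `M + 1` moving strands that compares a mixed
braid with the result of a braid band move on the first moving strand, modulo such functionals for
mixed braids with fewer strands. -/
structure IsMarkedFunctional {O G Q : Type*} [CommRing O] [Group G] [AddCommGroup Q] [Module O Q]
    (a b : O) (M : ℕ) (t : G) (s : ℕ → G) (φ : G → Q) : Prop where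
  hecke : φ ∈ heckeFunctions a b M s Q
  comm_s : ∀ α i, 0 < i → i < M → φ (s i * α) = φ (α * s i)
  word : ∀ d α, LoopWord t s (M - 1) d α → φ α = 0
  stab : ∀ d d' α β, LoopWord t s (M - 1) d α → LoopWord t s (M - 1) d' β →
    φ (α * s (M - 1) * β) = 0
  -- The conjugation shifts the loops of `α` up by one strand, so that the marked strand becomes
  -- trivial.
  split : ∀ d α, LoopWord t s (M - 1) d α → φ (ascProd s M * α * (ascProd s M)⁻¹) = 0
  mono : ∀ k : List ℤ, k.length = M + 1 → k.SortedGE → (∀ x ∈ k, x ≠ 0) → ∀ i ≤ M,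
    φ ((descProd s i)⁻¹ * zpowProd (loopSymm t s) 0 k * descProd s i) = 0

/-- The span of the values on the products of `t'_0^{k_0} ⋯ t'_M^{k_M}` with at most `d` loops. -/
def loopValues (O : Type*) {G Q : Type*} [CommRing O] [Group G] [AddCommGroup Q] [Module O Q]
    (M : ℕ) (t : G) (s : ℕ → G) (φ : G → Q) (d : ℕ) : Submodule O Q :=
  Submodule.span O ((fun k => φ (zpowProd (loopConj t s) 0 k)) ''
    {k : List ℤ | k.length = M + 1 ∧ absSum k ≤ d})

/-- The bound on the number of loops serves this purpose: it makes `loopValues` finitely generated,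
as Nakayama's lemma requires. -/
theorem finite_setOf_absSum_le (n d : ℕ) : {k : List ℤ | k.length = n ∧ absSum k ≤ d}.Finite := by
  induction n with
  | zero => exact (Set.finite_singleton []).subset fun k hk => List.length_eq_zero_iff.1 hk.1
  | succ n ih =>
    refine ((Set.finite_Icc (-d : ℤ) d).image2 List.cons ih).subset ?_
    rintro (_ | ⟨x, k⟩) ⟨h1, h2⟩
    · simp at h1
    · simp only [absSum_cons, List.length_cons] at h1 h2
      exact ⟨x, ⟨by omega, by omega⟩, k, ⟨by omega, by omega⟩, rfl⟩

theorem loopValues_fg (O : Type*) {G Q : Type*} [CommRing O] [Group G] [AddCommGroup Q] [Module O Q]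
    (M : ℕ) (t : G) (s : ℕ → G) (φ : G → Q) (d : ℕ) : (loopValues O M t s φ d).FG :=
  Submodule.fg_span ((finite_setOf_absSum_le _ _).image _)

/-! ### Reduction to values on products of loops. -/

namespace IsMarkedFunctional

variable {O G Q : Type*} [CommRing O] [Group G] [AddCommGroup Q] [Module O Q]
  {a b : O} {M : ℕ} {t : G} {s : ℕ → G} {φ : G → Q}

/-- A stabilized strand may be removed in the presence of further loops. -/
theorem stab_loops (h : IsMarkedFunctional a b M t s φ) (hG : IsTypeB M t s) {j n d d' : ℕ}
    {α β : G} (hn : j + n + 1 = M) (hα : LoopWord t s j d α) (hβ : LoopWord t s j d' β)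
    (l : List ℤ) (hl : l.length = n) :
    φ (α * s j * β * zpowProd (loopConj t s) (j + 2) l) = 0 := by
  induction l generalizing j n d d' α β with
  | nil =>
    obtain rfl : M - 1 = j := by simp at hl; omega
    simpa [zpowProd] using h.stab _ _ _ _ hα hβ
  | cons k l ih =>
    simp only [List.length_cons] at hl
    set R := zpowProd (loopConj t s) (j + 2 + 1) l with hR
    set c := loopConj t s (j + 1) ^ k with hc
    -- The final `(s (j + 1))⁻¹` of the first loop passes `R` and is then moved cyclically to the
    -- front, which is allowed because its index is positive. There the braid relation replaces the
    -- stabilizing letter `s j` by `s (j + 1)`: the stabilized strand climbs until it is the last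
    -- one.
    have hRc : Commute R (s (j + 1)) :=
      zpowProd_commute fun i hi hi' => hG.loopConj_commute (by omega) (by omega)
    have hαc : Commute α (s (j + 1)) := hG.commute_word hα (by omega)
    have hβc : Commute β (s (j + 1)) := hG.commute_word hβ (by omega)
    have e1 : α * s j * β * zpowProd (loopConj t s) (j + 2) (k :: l) =
        α * s j * β * (s (j + 1) * c) * R * (s (j + 1))⁻¹ := by
      change α * s j * β * (loopConj t s (j + 1 + 1) ^ k * R) = _
      rw [loopConj_succ_zpow, mul_assoc _ R, hRc.inv_right.eq]
      simp only [mul_assoc, hc]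
    have e2 : (s (j + 1))⁻¹ * (α * s j * β * (s (j + 1) * c) * R) =
        α * s j * s (j + 1) * ((s j)⁻¹ * β * c) * R := by
      calc _ = (s (j + 1))⁻¹ * α * s j * (β * s (j + 1)) * c * R := by group
        _ = α * ((s (j + 1))⁻¹ * s j * s (j + 1)) * β * c * R := by
          rw [hβc.eq, ← hαc.inv_right.eq]; group
        _ = _ := by rw [hG.braid_inv (by omega)]; group
    have e3 : ∀ x, φ (x * (s (j + 1))⁻¹) = φ ((s (j + 1))⁻¹ * x) := fun x => by
      have := h.comm_s ((s (j + 1))⁻¹ * x * (s (j + 1))⁻¹) (j + 1) (by omega) (by omega)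
      simpa [mul_assoc] using this
    rw [e1, e3, e2]
    refine ih (n := n - 1) (by omega) (.mul_s j (Nat.lt_succ_self j)
      (hα.mono (Nat.le_succ j) le_rfl)) (d' := 0 + d' + k.natAbs) ?_ (by omega)
    exact ((LoopWord.of_s_inv (Nat.lt_succ_self j)).mul (hβ.mono (Nat.le_succ j) le_rfl)).mul
      ((LoopWord.of_loopConj le_rfl).zpow k)

/-- Strands are peeled off from the right. With `R` the product of the loops already split off, `x ↦
φ (x * R)` is still a Hecke function, so the spanning theorem applies to `α`; stabilized terms
vanish by `stab_loops`, and loop terms prepend an exponent to `l`. -/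
theorem mem_loopValues_of_loops (h : IsMarkedFunctional a b M t s φ) (hG : IsTypeB M t s)
    (hb : IsUnit b) {j d d₁ : ℕ} {α : G} (hα : LoopWord t s j d₁ α) (l : List ℤ)
    (hl : j + l.length = M) (hd : d₁ + absSum l ≤ d) :
    φ (α * zpowProd (loopConj t s) (j + 1) l) ∈ loopValues O M t s φ d := by
  induction j generalizing d₁ α l with
  | zero =>
    obtain ⟨k, hk, rfl⟩ := hα.exists_zpow
    exact Submodule.subset_span ⟨k :: l, ⟨by simp; omega, by simp; omega⟩, rfl⟩
  | succ j ih =>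
    refine hG.hecke_mem_of_stab_loop (a := a) hb (ψ := fun x => φ (x * zpowProd (loopConj t s) (j + 2) l))
      (fun x y i hi => ?_) (j := j) (by omega) _ ?_ ?_ hα
    · simpa [mul_assoc] using h.hecke x (y * zpowProd (loopConj t s) (j + 2) l) i hi
    · intro d₁ d₂ α β hα hβ _
      rw [h.stab_loops hG (n := l.length) (by omega) hα hβ l rfl]
      exact Submodule.zero_mem _
    · intro d₁' α k hα hk
      rw [mul_assoc]
      exact ih hα (k :: l) (by simp; omega) (by simp; omega)

theorem mem_loopValues (h : IsMarkedFunctional a b M t s φ) (hG : IsTypeB M t s)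
    (hb : IsUnit b) {d : ℕ} {α : G} (hα : LoopWord t s M d α) : φ α ∈ loopValues O M t s φ d := by
  simpa [zpowProd] using h.mem_loopValues_of_loops hG hb hα [] (by simp) (d := d) (by simp)

end IsMarkedFunctional

/-! ### Crossing changes -/

/-- Two elements are related if they arise from each other by crossing changes that are visible in
words with at most `d` loops. -/
inductive CrossingEquiv {G : Type*} [Group G] (M : ℕ) (t : G) (s : ℕ → G) (d : ℕ) : G → G → Prop
  | refl (u : G) : CrossingEquiv M t s d u u
  | flip {d₁ d₂ : ℕ} {α β : G} {i : ℕ} (hα : LoopWord t s M d₁ α) (hβ : LoopWord t s M d₂ β)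
      (hd : d₁ + d₂ ≤ d) (hi : i < M) : CrossingEquiv M t s d (α * s i * β) (α * (s i)⁻¹ * β)
  | symm {u v : G} (h : CrossingEquiv M t s d u v) : CrossingEquiv M t s d v u
  | trans {u v w : G} (h : CrossingEquiv M t s d u v) (h' : CrossingEquiv M t s d v w) :
      CrossingEquiv M t s d u w

namespace CrossingEquiv

variable {G : Type*} [Group G] {t : G} {s : ℕ → G} {M : ℕ}

theorem mono {d d' : ℕ} {u v : G} (h : CrossingEquiv M t s d u v) (hd : d ≤ d') :
    CrossingEquiv M t s d' u v := by
  induction h with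
  | refl u => exact .refl u
  | flip hα hβ h hi => exact .flip hα hβ (h.trans hd) hi
  | symm _ ih => exact ih.symm
  | trans _ _ ih ih' => exact ih.trans ih'

theorem mul_left {d d' : ℕ} {u v γ : G} (hγ : LoopWord t s M d' γ) (h : CrossingEquiv M t s d u v) :
    CrossingEquiv M t s (d' + d) (γ * u) (γ * v) := by
  induction h with
  | refl u => exact .refl _
  | flip hα hβ h hi =>
    simp only [← mul_assoc]
    exact .flip (hγ.mul hα) hβ (by omega) hi
  | symm _ ih => exact ih.symm
  | trans _ _ ih ih' => exact ih.trans ih'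

theorem mul_right {d d' : ℕ} {u v γ : G} (h : CrossingEquiv M t s d u v)
    (hγ : LoopWord t s M d' γ) : CrossingEquiv M t s (d + d') (u * γ) (v * γ) := by
  induction h with
  | refl u => exact .refl _
  | flip hα hβ h hi =>
    simp only [mul_assoc]
    simp only [← mul_assoc _ (s _), ← mul_assoc _ (s _)⁻¹]
    exact .flip hα (hβ.mul hγ) (by omega) hi
  | symm _ ih => exact ih.symm
  | trans _ _ ih ih' => exact ih.trans ih'

theorem mul {d d' : ℕ} {u v u' v' : G} (h : CrossingEquiv M t s d u v)
    (h' : CrossingEquiv M t s d' u' v') (hu' : LoopWord t s M d' u') (hv : LoopWord t s M d v) :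
    CrossingEquiv M t s (d + d') (u * u') (v * v') :=
  (h.mul_right hu').trans (h'.mul_left hv)

theorem inv {d : ℕ} {u v : G} (h : CrossingEquiv M t s d u v) :
    CrossingEquiv M t s d u⁻¹ v⁻¹ := by
  induction h with
  | refl u => exact .refl _
  | flip hα hβ h hi =>
    simp only [mul_inv_rev, inv_inv, ← mul_assoc]
    exact (CrossingEquiv.flip hβ.inv hα.inv (by omega) hi).symm
  | symm _ ih => exact ih.symm
  | trans _ _ ih ih' => exact ih.trans ih'

theorem zpow {u v : G} (h : CrossingEquiv M t s 1 u v) (hu : LoopWord t s M 1 u)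
    (hv : LoopWord t s M 1 v) (k : ℤ) : CrossingEquiv M t s k.natAbs (u ^ k) (v ^ k) := by
  have hn : ∀ n : ℕ, CrossingEquiv M t s n (u ^ n) (v ^ n) := fun n => by
    induction n with
    | zero => simpa using CrossingEquiv.refl 1
    | succ n ih =>
      rw [pow_succ, pow_succ]
      exact ih.mul h hu (by simpa using hv.zpow n)
  obtain ⟨n, rfl | rfl⟩ := k.eq_nat_or_neg
  · simpa using hn n
  · simpa using (hn n).inv

theorem zpowProd {x y : ℕ → G} {i : ℕ} (l : List ℤ)
    (h : ∀ n < i + l.length, CrossingEquiv M t s 1 (x n) (y n))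
    (hx : ∀ n < i + l.length, LoopWord t s M 1 (x n))
    (hy : ∀ n < i + l.length, LoopWord t s M 1 (y n)) :
    CrossingEquiv M t s (absSum l) (zpowProd x i l) (zpowProd y i l) := by
  induction l generalizing i with
  | nil => exact .refl _
  | cons k l ih =>
    simp only [List.length_cons] at h hx hy
    refine (zpow (h i (by omega)) (hx i (by omega)) (hy i (by omega)) k).mul
      (ih (fun n hn => h n (by omega)) (fun n hn => hx n (by omega)) fun n hn => hy n (by omega))
      (LoopWord.zpowProd l fun n hn => hx n (by omega)) ((hy i (by omega)).zpow k)

theorem loopSymm_loopConj {i : ℕ} (hi : i ≤ M) :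
    CrossingEquiv M t s 1 (loopSymm t s i) (loopConj t s i) := by
  induction i with
  | zero => exact .refl _
  | succ i ih =>
    have h1 : CrossingEquiv M t s 1 (s i * loopSymm t s i * s i * 1)
        (s i * loopSymm t s i * (s i)⁻¹ * 1) :=
      .flip (d₁ := 0 + 1) ((LoopWord.of_s hi).mul (LoopWord.of_loopSymm (by omega))) (.one 0)
        (by omega) hi
    have h2 : CrossingEquiv M t s (0 + 1 + 0) (s i * loopSymm t s i * (s i)⁻¹)
        (s i * loopConj t s i * (s i)⁻¹) :=
      ((ih (by omega)).mul_left (LoopWord.of_s hi)).mul_right (LoopWord.of_s_inv hi)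
    rw [mul_one, mul_one] at h1
    exact h1.trans h2

theorem zpowProd_loopSymm_loopConj (l : List ℤ) (hl : l.length ≤ M + 1) :
    CrossingEquiv M t s (absSum l) (_root_.zpowProd (loopSymm t s) 0 l)
      (_root_.zpowProd (loopConj t s) 0 l) :=
  zpowProd l (fun n hn => loopSymm_loopConj (by omega))
    (fun n hn => LoopWord.of_loopSymm (by omega)) fun n hn => LoopWord.of_loopConj (by omega)

/-- Conjugation by `s_i` exchanges two neighbouring exponents, up to crossing changes. -/
theorem conj_swap (hG : IsTypeB M t s) (u l : List ℤ) (x y : ℤ)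
    (h : u.length + l.length + 2 = M + 1) :
    CrossingEquiv M t s (absSum (u ++ x :: y :: l))
      ((s u.length)⁻¹ * _root_.zpowProd (loopSymm t s) 0 (u ++ x :: y :: l) * s u.length)
      (_root_.zpowProd (loopSymm t s) 0 (u ++ y :: x :: l)) := by
  set i := u.length with hi
  set U := _root_.zpowProd (loopSymm t s) 0 u
  set V := _root_.zpowProd (loopSymm t s) (i + 1 + 1) l
  have hiM : i < M := by omega
  have hU : Commute U (s i) := zpowProd_commute fun n _ hn => hG.loopSymm_commute_of_lt (by omega)
  have hV : Commute V (s i) := zpowProd_commute fun n hn hn' => hG.loopSymm_commute hn (by omega)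
  have hUw : LoopWord t s M (absSum u) U := LoopWord.zpowProd u fun n hn =>
    LoopWord.of_loopSymm (by omega)
  have hVw : LoopWord t s M (absSum l) V := LoopWord.zpowProd l fun n hn =>
    LoopWord.of_loopSymm (by omega)
  have hw : ∀ n ≤ M, LoopWord t s M 1 (loopSymm t s n) := fun n hn => LoopWord.of_loopSymm hn
  set X := loopSymm t s i with hX
  set Y := loopSymm t s (i + 1) with hY
  have hYX : Y = s i * X * s i := rfl
  have hXY : Commute X Y := hG.loopSymm_commute_succ (by omega)
  -- As `Y = s i * X * s i`, one crossing change of the first letter turns `(s i)⁻¹ * X * s i` into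
  -- `Y`; likewise `(s i)⁻¹ * Y * s i = X * s i * s i` becomes `X`.
  have c1 : CrossingEquiv M t s 1 ((s i)⁻¹ * X * s i) Y := by
    simpa [hYX, mul_assoc] using (CrossingEquiv.flip (LoopWord.one 0)
      ((hw i hiM.le).mul (LoopWord.of_s hiM)) (d₂ := 1 + 0) (d := 1) (by omega) hiM).symm
  have c2 : CrossingEquiv M t s 1 ((s i)⁻¹ * Y * s i) X := by
    have := CrossingEquiv.flip ((hw i hiM.le).mul (LoopWord.of_s hiM)) (LoopWord.one 0)
      (d₁ := 1 + 0) (d := 1) (by omega) hiM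
    simpa [hYX, mul_assoc] using this
  have w1 : LoopWord t s M 1 ((s i)⁻¹ * X * s i) := by
    simpa using ((LoopWord.of_s_inv hiM).mul (hw i hiM.le)).mul (LoopWord.of_s hiM)
  have w2 : LoopWord t s M 1 ((s i)⁻¹ * Y * s i) := by
    simpa using ((LoopWord.of_s_inv hiM).mul (hw (i + 1) hiM)).mul (LoopWord.of_s hiM)
  have c3 := (c1.zpow w1 (hw _ hiM) x).mul (c2.zpow w2 (hw _ hiM.le) y) (w2.zpow y)
    ((hw (i + 1) hiM).zpow x)
  have c4 := (c3.mul_left hUw).mul_right hVw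
  have e1 : (s i)⁻¹ * _root_.zpowProd (loopSymm t s) 0 (u ++ x :: y :: l) * s i =
      U * (((s i)⁻¹ * X * s i) ^ x * ((s i)⁻¹ * Y * s i) ^ y) * V := by
    have hz : ∀ (g : G) (k : ℤ), ((s i)⁻¹ * g * s i) ^ k = (s i)⁻¹ * g ^ k * s i := fun g k => by
      simpa using conj_zpow (a := (s i)⁻¹) (b := g) (i := k)
    rw [zpowProd_append, zero_add, hz, hz]
    change (s i)⁻¹ * (U * (X ^ x * (Y ^ y * V))) * s i = _
    calc _ = (s i)⁻¹ * U * X ^ x * Y ^ y * (V * s i) := by simp only [mul_assoc]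
      _ = U * (s i)⁻¹ * X ^ x * Y ^ y * (s i * V) := by rw [hV.eq, hU.inv_right.eq]
      _ = _ := by group
  have e2 : _root_.zpowProd (loopSymm t s) 0 (u ++ y :: x :: l) = U * (Y ^ x * X ^ y) * V := by
    -- Conjugation has interchanged the two loops; they commute, so their order can be restored.
    rw [zpowProd_append, zero_add, (hXY.symm.zpow_zpow x y).eq]
    change U * (X ^ y * (Y ^ x * V)) = _
    simp only [mul_assoc]
  rw [e1, e2]
  exact c4.mono (by simp; omega)

/-- Moving the marked strand to the first place, up to crossing changes. -/
theorem conj_descProd (hG : IsTypeB M t s) (A B : List ℤ) (x : ℤ)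
    (h : A.length + B.length = M) :
    CrossingEquiv M t s (absSum (A ++ x :: B))
      ((descProd s A.length)⁻¹ * _root_.zpowProd (loopSymm t s) 0 (A ++ x :: B) *
        descProd s A.length)
      (_root_.zpowProd (loopSymm t s) 0 (x :: (A ++ B))) := by
  induction A using List.reverseRecOn generalizing B with
  | nil => simpa [descProd] using CrossingEquiv.refl _
  | append_singleton A y ih =>
    simp only [List.length_append, List.length_singleton] at h
    have hw : ∀ n ≤ M, LoopWord t s M 0 (descProd s n) := fun n hn => by
      induction n with
      | zero => exact .one 0
      | succ n ih => simpa [descProd] using (LoopWord.of_s hn).mul (ih (by omega))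
    have h1 := conj_swap hG A B y x (by omega)
    have h2 := (h1.mul_left (hw A.length (by omega)).inv).mul_right (hw A.length (by omega))
    have h3 := ih (y :: B) (by simp; omega)
    have hs : absSum (A ++ x :: y :: B) = absSum (A ++ y :: x :: B) := by simp; omega
    rw [hs] at h3
    have h4 := (h2.mono (by omega : _ ≤ absSum (A ++ y :: x :: B))).trans h3
    simpa [descProd, mul_assoc] using h4

end CrossingEquiv

/-! ### Vanishing of marked functionals -/

namespace IsMarkedFunctional

variable {O G Q : Type*} [CommRing O] [Group G] [AddCommGroup Q] [Module O Q]
  {a b : O} {M : ℕ} {t : G} {s : ℕ → G} {φ : G → Q} (h : IsMarkedFunctional a b M t s φ)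
  (hG : IsTypeB M t s) (hb : IsUnit b)
include h hG hb

/-- Crossing changes are invisible modulo `a`. -/
theorem mem_smul_iff_of_crossingEquiv {d : ℕ} {u v : G} (huv : CrossingEquiv M t s d u v) :
    φ u ∈ Ideal.span {a} • loopValues O M t s φ d ↔
      φ v ∈ Ideal.span {a} • loopValues O M t s φ d := by
  induction huv with
  | refl u => exact Iff.rfl
  | @flip d₁ d₂ α β i hα hβ hd hi =>
    -- This instance is the skein relation between `s i` and its inverse. Its smoothed term `α * β`
    -- has at most `d` loops, so with the coefficient `a` it lies in the submodule.
    have h1 := h.hecke α ((s i)⁻¹ * β) i hi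
    have h2 : φ (α * β) ∈ loopValues O M t s φ d :=
      h.mem_loopValues hG hb ((hα.mul hβ).mono le_rfl hd)
    rw [show α * (s i * s i) * ((s i)⁻¹ * β) = α * s i * β by group,
      show α * s i * ((s i)⁻¹ * β) = α * β by group, ← mul_assoc] at h1
    rw [h1, Submodule.add_mem_iff_right _
      (Submodule.smul_mem_smul (Ideal.mem_span_singleton_self a) h2)]
    exact Submodule.smul_mem_iff_of_isUnit _ hb
  | symm _ ih => exact ih.symm
  | trans _ _ ih ih' => exact ih.trans ih'

/-- The exponents of the unmarked strands may be permuted modulo `a`. -/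
theorem mem_smul_iff_of_perm {d : ℕ} {l l' : List ℤ} (hl : l.Perm l') (u : List ℤ) (hu : u ≠ [])
    (hlen : u.length + l.length = M + 1) (hd : absSum (u ++ l) ≤ d) :
    φ (zpowProd (loopSymm t s) 0 (u ++ l)) ∈ Ideal.span {a} • loopValues O M t s φ d ↔
      φ (zpowProd (loopSymm t s) 0 (u ++ l')) ∈ Ideal.span {a} • loopValues O M t s φ d := by
  induction hl generalizing u with
  | nil => exact Iff.rfl
  | cons x _ ih =>
    have := ih (u ++ [x]) (by simp) (by simp at hlen ⊢; omega) (by simpa using hd)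
    simpa using this
  | swap x y l =>
    -- The swap conjugates by `s u.length`; a positive index leaves the marked strand untouched, so
    -- `φ` does not change.
    have hpos : 0 < u.length := List.length_pos_iff.2 hu
    simp only [List.length_cons] at hlen
    have h1 := (CrossingEquiv.conj_swap hG u l y x (by omega)).mono hd
    rw [← h.mem_smul_iff_of_crossingEquiv hG hb h1, ← h.comm_s _ _ hpos (by omega),
      mul_inv_cancel_left]
  | trans h1 h2 ih1 ih2 =>
    exact (ih1 u hu hlen hd).trans (ih2 u hu (h1.length_eq ▸ hlen)
      (by simpa [h1.absSum_eq] using hd))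

/-- Three cases. If the marked exponent is 0, `split` applies. If an unmarked exponent is 0, it is
permuted to the end, where the last strand drops out. Otherwise the exponents are sorted and the
value is compared with that of an element of Λ with a suitable marking. -/
theorem mem_smul_loopValues (hM : 0 < M) {d : ℕ} (k : List ℤ) (hk : k.length = M + 1)
    (hd : absSum k ≤ d) :
    φ (zpowProd (loopConj t s) 0 k) ∈ Ideal.span {a} • loopValues O M t s φ d := by
  obtain ⟨x, l, rfl⟩ : ∃ x l, k = x :: l := by
    cases k with
    | nil => simp at hk
    | cons x l => exact ⟨x, l, rfl⟩
  simp only [List.length_cons, Nat.add_right_cancel_iff] at hk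
  by_cases hx : x = 0
  · have h1 : zpowProd (loopConj t s) 0 (x :: l) =
        ascProd s M * zpowProd (loopConj t s) 0 l * (ascProd s M)⁻¹ := by
      rw [(hG.ascProd_conj_zpowProd le_rfl l (by omega)).eq, mul_inv_cancel_right, hx, zpowProd,
        zpow_zero, one_mul]
    rw [h1, h.split (absSum l) _ (LoopWord.zpowProd l fun n hn => LoopWord.of_loopConj (by omega))]
    exact Submodule.zero_mem _
  rw [← h.mem_smul_iff_of_crossingEquiv hG hb
    ((CrossingEquiv.zpowProd_loopSymm_loopConj (x :: l) (by simp [hk])).mono hd)]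
  by_cases h0 : 0 ∈ l
  · have hp : l.Perm (l.erase 0 ++ [0]) :=
      (List.perm_cons_erase h0).trans (List.perm_append_singleton _ _).symm
    have hlen := hp.length_eq
    simp only [List.length_append, List.length_singleton] at hlen
    rw [← List.singleton_append, h.mem_smul_iff_of_perm hG hb hp [x] (by simp)
      (by simp; omega) (by simpa using hd), ← List.append_assoc, zpowProd_append]
    simp only [zpowProd, zpow_zero, mul_one]
    rw [h.word (absSum ([x] ++ l.erase 0)) _ (LoopWord.zpowProd _ fun n hn =>
      LoopWord.of_loopSymm (by simp at hn; omega))]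
    exact Submodule.zero_mem _
  · set L := (x :: l).insertionSort (· ≥ ·) with hL
    have hp : L.Perm (x :: l) := List.perm_insertionSort _ _
    obtain ⟨A, B, hAB⟩ := List.append_of_mem (hp.mem_iff.2 (List.mem_cons_self (a := x)))
    have hp' : l.Perm (A ++ B) :=
      ((hp.symm.trans (hAB ▸ List.perm_middle)).cons_inv)
    have hlen := hp'.length_eq
    simp only [List.length_append] at hlen
    have hs : L.SortedGE := List.sortedGE_insertionSort
    have hz := h.mono L (by simp [hp.length_eq, hk]) hs (fun y hy hy0 => by
      rcases List.mem_cons.1 (hp.mem_iff.1 hy) with rfl | hy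
      · exact hx hy0
      · exact h0 (hy0 ▸ hy)) A.length (by omega)
    rw [← List.singleton_append, h.mem_smul_iff_of_perm hG hb hp' [x] (by simp)
      (by simp; omega) (by simpa using hd), List.singleton_append,
      ← h.mem_smul_iff_of_crossingEquiv hG hb
        ((CrossingEquiv.conj_descProd hG A B x (by omega)).mono (hAB ▸ hp.absSum_eq ▸ hd)), ← hAB, hz]
    exact Submodule.zero_mem _

/-- A marked functional vanishes if `a` lies in the Jacobson radical. -/
theorem eq_zero (hM : 0 < M) (ha : a ∈ Ideal.jacobson (⊥ : Ideal O)) {d : ℕ} {α : G}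
    (hα : LoopWord t s M d α) : φ α = 0 := by
  have hle : loopValues O M t s φ d ≤ Ideal.span {a} • loopValues O M t s φ d := by
    refine Submodule.span_le.2 ?_
    rintro _ ⟨k, ⟨hk, hd⟩, rfl⟩
    exact h.mem_smul_loopValues hG hb hM k hk hd
  have hbot := Submodule.eq_bot_of_le_smul_of_le_jacobson_bot _ _ (loopValues_fg O M t s φ d) hle
    ((Ideal.span_singleton_le_iff_mem _).2 ha)
  have hmem := h.mem_loopValues hG hb hα
  rwa [hbot, Submodule.mem_bot] at hmem

end IsMarkedFunctional

/-! ### The Artin groups of type B -/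

theorem zpowProd_ofFn {G : Type*} [Group G] (x : ℕ → G) (j n : ℕ) (k : Fin n → ℤ) :
    zpowProd x j (List.ofFn k) = (List.ofFn fun i : Fin n => x (j + i) ^ k i).prod := by
  induction n generalizing j with
  | zero => simp [zpowProd]
  | succ n ih => simp [List.ofFn_succ, zpowProd, ih, add_assoc, add_comm 1]

namespace ArtinB

variable {m : ℕ}

/-- The generators `σ_{i+1}`, indexed by natural numbers; the others are set to `1`. -/
def gen (m i : ℕ) : ArtinB m := if h : i < m then σ ⟨i, h⟩ else 1

theorem gen_of_lt {i : ℕ} (h : i < m) : gen m i = σ ⟨i, h⟩ := dif_pos h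

theorem gen_val (i : Fin m) : gen m i = σ i := gen_of_lt i.2

theorem isTypeB (m : ℕ) : IsTypeB m (t : ArtinB m) (gen m) where
  loop := by
    by_cases h : 0 < m
    · rw [gen_of_lt h, rel_loop _ rfl]
    · simp [gen, h]
  comm i hi := by
    by_cases h : i < m
    · rw [gen_of_lt h, rel_comm _ hi]
    · simp [gen, h]
  braid i hi := by
    rw [gen_of_lt hi, gen_of_lt (by omega : i < m), rel_braid _ _ rfl]
  far i j hij := by
    by_cases h : j < m
    · rw [gen_of_lt h, gen_of_lt (by omega : i < m), rel_far _ _ hij]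
    · simp [gen, h]

theorem exists_loopWord (α : ArtinB m) : ∃ d, LoopWord t (gen m) m d α := by
  have h : α ∈ Subgroup.closure (Set.range (PresentedGroup.of (rels := {x | BRel m x}))) := by
    rw [PresentedGroup.closure_range_of]; trivial
  induction h using Subgroup.closure_induction with
  | mem x hx =>
    obtain ⟨g, rfl⟩ := hx
    cases g with
    | t => exact ⟨1, LoopWord.of_t⟩
    | s i =>
      have h : gen m i = PresentedGroup.of (BGen.s i) := gen_val i
      exact ⟨0, h ▸ LoopWord.of_s i.2⟩
  | one => exact ⟨0, .one 0⟩
  | mul x y _ _ hx hy =>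
    obtain ⟨d, hx⟩ := hx
    obtain ⟨d', hy⟩ := hy
    exact ⟨_, hx.mul hy⟩
  | inv x _ hx =>
    obtain ⟨d, hx⟩ := hx
    exact ⟨d, hx.inv⟩

@[simp] theorem lift_t {G : Type*} [Group G] (a : G) (b : Fin m → G) (h1 h2 h3 h4) :
    lift a b h1 h2 h3 h4 t = a := by simp [lift, t]

@[simp] theorem lift_σ {G : Type*} [Group G] (a : G) (b : Fin m → G) (h1 h2 h3 h4) (i : Fin m) :
    lift a b h1 h2 h3 h4 (σ i) = b i := by simp [lift, σ]

@[simp] theorem incl_t : incl (t : ArtinB m) = t := lift_t _ _ _ _ _ _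

@[simp] theorem incl_σ (i : Fin m) : incl (σ i) = σ i.castSucc := lift_σ _ _ _ _ _ _ _

@[simp] theorem shift_t : shift (t : ArtinB m) = σ 0 * t * σ 0 := lift_t _ _ _ _ _ _

@[simp] theorem shift_σ (i : Fin m) : shift (σ i) = σ i.succ := lift_σ _ _ _ _ _ _ _

@[simp] theorem expSum_t : expSum (t : ArtinB m) = 1 := lift_t _ _ _ _ _ _

@[simp] theorem expSum_σ (i : Fin m) : expSum (σ i) = Multiplicative.ofAdd 1 := lift_σ _ _ _ _ _ _ _

/-- Homomorphisms on `ArtinB m` that agree on the generators are equal. -/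
theorem hom_ext {G : Type*} [Group G] {f g : ArtinB m →* G} (ht : f t = g t)
    (hσ : ∀ i, f (σ i) = g (σ i)) : f = g := by
  refine PresentedGroup.ext fun x => ?_
  cases x with
  | t => exact ht
  | s i => exact hσ i

theorem incl_gen {i : ℕ} (hi : i < m) : incl (gen m i) = gen (m + 1) i := by
  rw [gen_of_lt hi, incl_σ, gen_of_lt (by omega)]; rfl

theorem shift_gen {i : ℕ} (hi : i < m) : shift (gen m i) = gen (m + 1) (i + 1) := by
  rw [gen_of_lt hi, shift_σ, gen_of_lt (by omega)]; rfl

theorem shift_incl (α : ArtinB m) : shift (incl α) = incl (shift α) := by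
  have h : (shift.comp incl : ArtinB m →* ArtinB (m + 2)) = incl.comp shift :=
    hom_ext (by simp) (by simp)
  exact DFunLike.congr_fun h α

theorem expSum_incl (α : ArtinB m) : expSum (incl α) = expSum α := by
  have h : (expSum.comp incl : ArtinB m →* _) = expSum := hom_ext (by simp) (by simp)
  exact DFunLike.congr_fun h α

theorem exists_incl_eq {d : ℕ} {α : ArtinB (m + 1)} (h : LoopWord t (gen (m + 1)) m d α) :
    ∃ β : ArtinB m, incl β = α := by
  induction h with
  | one d => exact ⟨1, map_one _⟩
  | mul_s i hi _ ih =>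
    obtain ⟨β, rfl⟩ := ih
    exact ⟨β * gen m i, by rw [map_mul, incl_gen hi]⟩
  | mul_s_inv i hi _ ih =>
    obtain ⟨β, rfl⟩ := ih
    exact ⟨β * (gen m i)⁻¹, by rw [map_mul, map_inv, incl_gen hi]⟩
  | mul_t _ ih =>
    obtain ⟨β, rfl⟩ := ih
    exact ⟨β * t, by rw [map_mul, incl_t]⟩
  | mul_t_inv _ ih =>
    obtain ⟨β, rfl⟩ := ih
    exact ⟨β * t⁻¹, by rw [map_mul, map_inv, incl_t]⟩

theorem tt_eq_loopSymm (i : Fin (m + 1)) : tt i = loopSymm t (gen m) i := by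
  induction i using Fin.induction with
  | zero => rfl
  | succ i ih =>
    change σ i * tt i.castSucc * σ i = gen m i * loopSymm t (gen m) i * gen m i
    rw [ih, gen_val]; rfl

theorem desc_eq_descProd (i : Fin (m + 1)) : desc i = descProd (gen m) i := by
  induction i using Fin.induction with
  | zero => rfl
  | succ i ih =>
    change σ i * desc i.castSucc = gen m i * descProd (gen m) i
    rw [ih, gen_val]; rfl

theorem mono_eq_zpowProd (k : Fin (m + 1) → ℤ) :
    mono le_rfl k = zpowProd (loopSymm t (gen m)) 0 (List.ofFn k) := by
  rw [zpowProd_ofFn, mono]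
  simp [tt_eq_loopSymm]

/-- The loop `t` commutes with shifted mixed braids. -/
theorem commute_t_shift (α : ArtinB m) : Commute (t : ArtinB (m + 1)) (shift α) := by
  have h : (MulAut.conj (t : ArtinB (m + 1))).toMonoidHom.comp (shift : ArtinB m →* _) = shift := by
    refine hom_ext ?_ fun i => ?_
    · simp only [MonoidHom.comp_apply, shift_t, MulEquiv.toMonoidHom_eq_coe, MonoidHom.coe_coe,
        MulAut.conj_apply]
      have := rel_loop (0 : Fin (m + 1)) rfl
      rw [mul_inv_eq_iff_eq_mul, this]; group
    · simp only [MonoidHom.comp_apply, shift_σ, MulEquiv.toMonoidHom_eq_coe, MonoidHom.coe_coe,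
        MulAut.conj_apply]
      rw [mul_inv_eq_iff_eq_mul, rel_comm _ (by simp)]
  have := DFunLike.congr_fun h α
  simp only [MonoidHom.comp_apply, MulEquiv.toMonoidHom_eq_coe, MonoidHom.coe_coe,
    MulAut.conj_apply] at this
  exact mul_inv_eq_iff_eq_mul.1 this

theorem shift_ascProd {n : ℕ} (hn : n ≤ m) :
    ascProd (gen (m + 1)) (n + 1) = gen (m + 1) 0 * shift (ascProd (gen m) n) := by
  induction n with
  | zero => simp [ascProd]
  | succ n ih =>
    rw [ascProd, ih (by omega)]
    simp only [ascProd]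
    rw [map_mul, shift_gen (by omega), mul_assoc]

theorem incl_ascProd {n : ℕ} (hn : n ≤ m) :
    incl (ascProd (gen m) n) = ascProd (gen (m + 1)) n := by
  induction n with
  | zero => simp [ascProd]
  | succ n ih => rw [ascProd, map_mul, ih (by omega), incl_gen hn, ascProd]

/-- The conjugate of the first generator that appears when a trivial strand is moved to the end. -/
theorem shift_ascProd_conj (m : ℕ) :
    (shift (ascProd (gen (m + 1)) (m + 1)))⁻¹ * σ 0 * shift (ascProd (gen (m + 1)) (m + 1)) =
      incl (ascProd (gen (m + 1)) (m + 1)) * σ (Fin.last (m + 1)) *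
        (incl (ascProd (gen (m + 1)) (m + 1)))⁻¹ := by
  set D := ascProd (gen (m + 1)) (m + 1) with hD
  -- The full ascending product has two factorizations, `σ 0 * shift D` and `incl D * σ (Fin.last
  -- _)`, and conjugation by it carries `incl D` to `shift D`. Comparing these gives the claim.
  have h1 : ascProd (gen (m + 2)) (m + 2) = σ 0 * shift D := by
    rw [shift_ascProd le_rfl, gen_of_lt (by omega)]; rfl
  have h2 : ascProd (gen (m + 2)) (m + 2) = incl D * σ (Fin.last (m + 1)) := by
    rw [incl_ascProd le_rfl, ascProd, gen_of_lt (by omega)]; rfl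
  have h3 : ∀ n ≤ m + 1, SemiconjBy (ascProd (gen (m + 2)) (m + 2))
      (incl (ascProd (gen (m + 1)) n)) (shift (ascProd (gen (m + 1)) n)) := fun n hn => by
    induction n with
    | zero => simp [ascProd]
    | succ n ih =>
      simp only [ascProd, map_mul]
      rw [incl_gen hn, shift_gen hn]
      exact (ih (by omega)).mul_right ((isTypeB _).ascProd_conj_s (by omega) le_rfl)
  have h4 := (h3 _ le_rfl).eq
  rw [← hD] at h4
  rw [mul_assoc, ← h1, inv_mul_eq_iff_eq_mul, ← mul_assoc, eq_mul_inv_iff_mul_eq, h4, h2]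

end ArtinB

/-! ### The Markov trace and the invariant `X` -/

namespace HeckeB

theorem incl_π {R : Type*} [CommRing R] (q : R) {m : ℕ} (α : ArtinB m) :
    incl R q m (π R q m α) = π R q (m + 1) (ArtinB.incl α) := by
  change RingQuot.liftAlgHom R _ (RingQuot.mkAlgHom R _ _) = _
  rw [RingQuot.liftAlgHom_mkAlgHom_apply, MonoidAlgebra.lift_of]
  rfl

theorem π_σ_mul_self {R : Type*} [CommRing R] (q : R) {m : ℕ} (i : Fin m) :
    π R q m (ArtinB.σ i * ArtinB.σ i) = (q - 1) • π R q m (ArtinB.σ i) + q • 1 := by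
  have h : mk R q m _ = mk R q m _ :=
    RingQuot.mkAlgHom_rel R (HeckeRel.quad (R := R) (q := q) (m := m) i)
  rw [map_pow, map_add, map_smul, map_smul, map_one] at h
  rw [map_mul, ← pow_two]
  exact h

end HeckeB

section Trace

variable {K : Type*} [Field K] (q z : K)

theorem C_smul_traceModule (k : K) (x : TraceModule K q z) :
    (MvPolynomial.C k : SRing K) • x = k • x := rfl

theorem tr_eq_of_markovRel {m n : ℕ} {a : HAlg K q m} {b : HAlg K q n} {c : SRing K}
    (h : MarkovRel K q z (DirectSum.lof (SRing K) ℕ (HAlg K q) m a -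
      c • DirectSum.lof (SRing K) ℕ (HAlg K q) n b)) : tr q z m a = c • tr q z n b := by
  have h1 := (Submodule.Quotient.mk_eq_zero _).2 (Submodule.subset_span (R := SRing K) h)
  rw [Submodule.Quotient.mk_sub, sub_eq_zero] at h1
  exact h1

theorem tr_mul_comm {m : ℕ} (a b : HAlg K q m) : tr q z m (a * b) = tr q z m (b * a) := by
  have h := MarkovRel.cyclic (z := z) m a b
  rw [← one_smul (SRing K) (DirectSum.lof (SRing K) ℕ (HAlg K q) m (b * a))] at h
  simpa using tr_eq_of_markovRel q z h

theorem tr_incl {m : ℕ} (a : HAlg K q m) :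
    tr q z (m + 1) (HeckeB.incl _ _ m a) = tr q z m a := by
  have h := MarkovRel.union (z := z) m a
  rw [← one_smul (SRing K) (DirectSum.lof (SRing K) ℕ (HAlg K q) m a)] at h
  simpa using tr_eq_of_markovRel q z h

theorem tr_stab {m : ℕ} (a : HAlg K q m) :
    tr q z (m + 1) (HeckeB.incl _ _ m a * HeckeB.π _ _ _ (ArtinB.σ (Fin.last m))) =
      z • tr q z m a :=
  tr_eq_of_markovRel q z (MarkovRel.stab m a)

end Trace

/-! ### Skein relation and Markov moves for X. -/

section Invariant

variable {K : Type*} [Field K] (q z r : K)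

open ArtinB

theorem invX_mul_comm {m : ℕ} (α β : ArtinB m) : invX q z r (α * β) = invX q z r (β * α) := by
  simp only [invX, map_mul, mul_comm (expSum α), tr_mul_comm q z (HeckeB.π _ _ _ α)]

theorem invX_incl {m : ℕ} (α : ArtinB m) :
    invX q z r (incl α) = (-((1 - lam q z * q) / (r * (1 - q)))) • invX q z r α := by
  simp only [invX, expSum_incl, ← HeckeB.incl_π, tr_incl, smul_smul]
  congr 1
  ring

/-- The factor `r ^ e` rescales the quadratic relation: each crossing lost on the right side costs
one factor `r`. -/
theorem invX_hecke (hr : r ≠ 0) {m : ℕ} (α β : ArtinB m) (i : Fin m) :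
    invX q z r (α * (σ i * σ i) * β) =
      ((q - 1) * r) • invX q z r (α * σ i * β) + (q * r ^ 2) • invX q z r (α * β) := by
  have h1 : tr q z m (HeckeB.π _ _ m (α * (σ i * σ i) * β)) =
      (q - 1) • tr q z m (HeckeB.π _ _ m (α * σ i * β)) + q • tr q z m (HeckeB.π _ _ m (α * β)) := by
    have hq : (MvPolynomial.C q - 1 : SRing K) = MvPolynomial.C (q - 1) := by simp
    rw [map_mul (HeckeB.π _ _ m), map_mul (HeckeB.π _ _ m), HeckeB.π_σ_mul_self, mul_add, add_mul,
      mul_smul_comm, mul_smul_comm, smul_mul_assoc, smul_mul_assoc, mul_one,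
      map_add (tr q z m), map_smul (tr q z m), map_smul (tr q z m), ← map_mul, ← map_mul, ← map_mul,
      hq, C_smul_traceModule, C_smul_traceModule]
  have h2 : ∀ e : ℤ, r ^ (e + 1) = r ^ e * r := zpow_add_one₀ hr
  rw [invX, invX, invX, h1]
  simp only [smul_add, smul_smul, map_mul expSum, expSum_σ, toAdd_mul, toAdd_ofAdd]
  congr 2
  · rw [show (expSum α).toAdd + (1 + 1) + (expSum β).toAdd =
      (expSum α).toAdd + 1 + (expSum β).toAdd + 1 by ring, h2]
    ring
  · rw [show (expSum α).toAdd + (1 + 1) + (expSum β).toAdd =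
      (expSum α).toAdd + (expSum β).toAdd + 1 + 1 by ring, h2, h2]
    ring

end Invariant

/-- The parameters are in general position. -/
structure IsGenericParam {K : Type*} [Field K] (q z r : K) : Prop where
  q_ne_one : q ≠ 1
  q_ne_zero : q ≠ 0
  z_ne_zero : z ≠ 0
  r_ne_zero : r ≠ 0
  sq_eq : r ^ 2 = lam q z

namespace IsGenericParam

variable {K : Type*} [Field K] {q z r : K} (h : IsGenericParam q z r)
include h

open ArtinB

theorem mul_sq_mul : q * r ^ 2 * z = z + 1 - q := by
  have := h.q_ne_zero
  have := h.z_ne_zero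
  rw [h.sq_eq, lam]
  field_simp

/-- The normalization of X per strand is chosen for this identity: it cancels the factor `z` of the
trace and the factor `r` of the new crossing under a positive stabilization. -/
theorem loop_factor : -((1 - lam q z * q) / (r * (1 - q))) * (r * z) = 1 := by
  have h1 : (1 - q) ≠ 0 := sub_ne_zero.2 h.q_ne_one.symm
  have h2 := h.r_ne_zero
  have h3 := h.mul_sq_mul
  rw [← h.sq_eq]
  field_simp
  linear_combination h3

/-- This compatibility of the value of a trivial strand with the skein relation gives invariance
under negative stabilization, and the cancellation in `bbmDiff_split`. -/
theorem skein_factor :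
    (q - 1) * r * -((1 - lam q z * q) / (r * (1 - q))) = 1 - q * r ^ 2 := by
  have h1 : (1 - q) ≠ 0 := sub_ne_zero.2 h.q_ne_one.symm
  have h2 := h.r_ne_zero
  rw [← h.sq_eq]
  field_simp
  ring

theorem invX_stab_right {m : ℕ} (α : ArtinB m) :
    invX q z r (incl α * σ (Fin.last m)) = invX q z r α := by
  simp only [invX, map_mul, expSum_incl, ← HeckeB.incl_π, tr_stab, smul_smul, expSum_σ, toAdd_mul,
    toAdd_ofAdd]
  congr 1
  rw [zpow_add_one₀ h.r_ne_zero]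
  linear_combination (-((1 - lam q z * q) / (r * (1 - q)))) ^ m *
    r ^ (expSum α).toAdd * h.loop_factor

/-- The skein relation for a crossing and its inverse. -/
theorem invX_skein {m : ℕ} (α β : ArtinB m) (i : Fin m) :
    invX q z r (α * σ i * β) = ((q - 1) * r) • invX q z r (α * β) +
      (q * r ^ 2) • invX q z r (α * (σ i)⁻¹ * β) := by
  have := invX_hecke q z r h.r_ne_zero α ((σ i)⁻¹ * β) i
  simpa [mul_assoc] using this

theorem invX_stab {m : ℕ} (ε : ℤˣ) (α β : ArtinB m) :
    invX q z r (incl α * σ (Fin.last m) ^ (ε : ℤ) * incl β) = invX q z r (α * β) := by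
  have h1 : invX q z r (incl α * σ (Fin.last m) * incl β) = invX q z r (α * β) := by
    rw [invX_mul_comm, ← mul_assoc, ← map_mul, h.invX_stab_right, invX_mul_comm]
  rcases Int.units_eq_one_or ε with rfl | rfl
  · simpa using h1
  · have h2 := h.invX_skein (incl α) (incl β) (Fin.last m)
    have h3 : q * r ^ 2 ≠ 0 := mul_ne_zero h.q_ne_zero (pow_ne_zero 2 h.r_ne_zero)
    rw [h1, ← map_mul, invX_incl, smul_smul, h.skein_factor] at h2
    have h4 : (q * r ^ 2) • invX q z r (α * β) =
        (q * r ^ 2) • invX q z r (incl α * (σ (Fin.last m))⁻¹ * incl β) := by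
      rw [eq_comm, ← sub_eq_of_eq_add' h2, sub_smul, one_smul, sub_sub_cancel]
    simpa using (smul_right_injective _ h3 h4).symm

end IsGenericParam

/-! ### Braid band moves -/

/-- The difference of the two sides of the equation for a braid band move on the first moving
strand. -/
noncomputable def bbmDiff {K : Type*} [Field K] (q z r : K) (p : ℤ) (ε : ℤˣ) {m : ℕ} (α : ArtinB m) :
    TraceModule K q z :=
  invX q z r α - invX q z r (ArtinB.slFirst p ε α)

namespace IsGenericParam

variable {K : Type*} [Field K] {q z r : K} (h : IsGenericParam q z r) (p : ℤ) (ε : ℤˣ)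
include h

open ArtinB

/-- A band move multiplies on the left by a fixed element and shifts indices, so both sides of its
equation obey the same quadratic relation. -/
theorem bbmDiff_hecke {m : ℕ} (α β : ArtinB m) (i : Fin m) :
    bbmDiff q z r p ε (α * (σ i * σ i) * β) =
      ((q - 1) * r) • bbmDiff q z r p ε (α * σ i * β) + (q * r ^ 2) • bbmDiff q z r p ε (α * β) := by
  have h1 := invX_hecke q z r h.r_ne_zero α β i
  have h2 := invX_hecke q z r h.r_ne_zero (t ^ p * σ 0 ^ (ε : ℤ) * shift α) (shift β) i.succ
  simp only [bbmDiff, slFirst, map_mul, shift_σ, mul_assoc] at h1 h2 ⊢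
  rw [h1, h2]
  module

-- After the shift such a generator has index at least two (counted from 0), so it commutes with `t
-- ^ p * σ 0 ^ ε`, and X is invariant under conjugation.
omit h in
theorem bbmDiff_mul_σ {m : ℕ} (α : ArtinB m) (i : Fin m) (hi : 0 < (i : ℕ)) :
    bbmDiff q z r p ε (σ i * α) = bbmDiff q z r p ε (α * σ i) := by
  have h1 : Commute (σ i.succ) (t ^ p * σ (0 : Fin (m + 1)) ^ (ε : ℤ)) := by
    have h2 : Commute (σ i.succ) (t : ArtinB (m + 1)) := (rel_comm _ (by simp)).symm
    have h3 : Commute (σ i.succ) (σ (0 : Fin (m + 1))) := (rel_far _ _ (by simpa using hi)).symm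
    exact (h2.zpow_right p).mul_right (h3.zpow_right _)
  simp only [bbmDiff, slFirst]
  rw [invX_mul_comm q z r (σ i), map_mul, map_mul, shift_σ, ← mul_assoc, ← h1.eq, mul_assoc,
    invX_mul_comm q z r (σ i.succ), mul_assoc]

omit h in
theorem bbmDiff_incl {m : ℕ} (α : ArtinB m) :
    bbmDiff q z r p ε (incl α) =
      (-((1 - lam q z * q) / (r * (1 - q)))) • bbmDiff q z r p ε α := by
  have h1 : slFirst p ε (incl α) = incl (slFirst p ε α) := by
    simp [slFirst, shift_incl]
  rw [bbmDiff, h1, invX_incl, invX_incl, ← smul_sub]; rfl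

theorem bbmDiff_stab {m : ℕ} (α β : ArtinB m) :
    bbmDiff q z r p ε (incl α * σ (Fin.last m) * incl β) = bbmDiff q z r p ε (α * β) := by
  have h1 := h.invX_stab 1 α β
  have h2 := h.invX_stab 1 (slFirst p ε α) (shift β)
  have h3 : slFirst p ε (incl α * σ (Fin.last m) * incl β) =
      incl (slFirst p ε α) * σ (Fin.last (m + 1)) * incl (shift β) := by
    simp [slFirst, shift_incl, mul_assoc]
  simp only [Units.val_one, zpow_one] at h1 h2
  rw [bbmDiff, h3, h1, h2, bbmDiff, slFirst, slFirst, map_mul, mul_assoc]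

/-- A braid band move on a trivial strand, written with braid band moves on a mixed braid with fewer
strands. -/
theorem bbmDiff_split {m : ℕ} (α : ArtinB m) :
    ((q - 1) * r) • bbmDiff q z r p ε (ascProd (gen (m + 1)) (m + 1) * incl α *
        (ascProd (gen (m + 1)) (m + 1))⁻¹) =
      bbmDiff q z r p 1 α - (q * r ^ 2) • bbmDiff q z r p (-1) α := by
  set D := ascProd (gen (m + 1)) (m + 1) with hD
  have h1 : invX q z r (D * incl α * D⁻¹) =
      (-((1 - lam q z * q) / (r * (1 - q)))) • invX q z r α := by
    rw [invX_mul_comm, inv_mul_cancel_left, invX_incl]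
  -- The marked strand is trivial, so the crossing of the band is conjugate to a stabilization on
  -- the last strand. Removing it makes the sign `ε` disappear.
  have h2 : invX q z r (slFirst p ε (D * incl α * D⁻¹)) = invX q z r (t ^ p * shift α) := by
    have e1 : (shift D)⁻¹ * σ 0 ^ (ε : ℤ) * shift D =
        incl D * σ (Fin.last (m + 1)) ^ (ε : ℤ) * (incl D)⁻¹ := by
      have := conj_zpow (a := (shift D)⁻¹) (b := σ 0) (i := (ε : ℤ))
      rw [inv_inv] at this
      rw [← this, hD, shift_ascProd_conj, conj_zpow]
    have e2 : (shift D)⁻¹ * (t ^ p * σ 0 ^ (ε : ℤ) * shift D * incl (shift α)) =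
        incl (t ^ p * D) * σ (Fin.last (m + 1)) ^ (ε : ℤ) * incl (D⁻¹ * shift α) := by
      have ht := ((commute_t_shift D).zpow_left p).inv_right.eq
      calc _ = (t ^ p * (shift D)⁻¹) * σ 0 ^ (ε : ℤ) * shift D * incl (shift α) := by
            rw [ht]; group
        _ = t ^ p * ((shift D)⁻¹ * σ 0 ^ (ε : ℤ) * shift D) * incl (shift α) := by group
        _ = _ := by rw [e1]; simp [mul_assoc]
    rw [slFirst, map_mul, map_mul, map_inv, shift_incl, ← mul_assoc, ← mul_assoc, invX_mul_comm,
      e2, h.invX_stab, mul_assoc, mul_inv_cancel_left]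
  -- The braid without crossing is recovered as a skein combination of the band moves of both signs
  -- on `α`.
  have h3 := h.invX_skein (t ^ p) (shift α) 0
  rw [bbmDiff, h1, h2]
  simp only [bbmDiff, slFirst, Units.val_one, zpow_one, Units.val_neg, zpow_neg, h3,
    smul_sub, smul_smul, h.skein_factor]
  module

end IsGenericParam

/-! ### Specialization at `q = z = 1` -/

section Specialization

variable {K : Type*} [Field K] {q z r : K}

/-- A polynomial with a nonzero value at some point is nonzero, and hence nonzero at algebraically
independent elements. -/
theorem AlgebraicIndependent.aeval_ne_zero_of_eval {ι R A : Type*} [CommRing R] [CommRing A]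
    [Algebra R A] {x : ι → A} (hx : AlgebraicIndependent R x) (P : MvPolynomial ι R) (y : ι → R)
    (hP : MvPolynomial.eval y P ≠ 0) : MvPolynomial.aeval x P ≠ 0 := fun h => by
  rw [← map_zero (MvPolynomial.aeval (R := R) x)] at h
  exact hP (by rw [hx h, map_zero])

theorem isGenericParam_of_algebraicIndependent (hqz : AlgebraicIndependent ℤ ![q, z])
    (hr : r ^ 2 = lam q z) : IsGenericParam q z r := by
  have h1 := hqz.aeval_ne_zero_of_eval (MvPolynomial.X 0 - 1) (fun _ => 0) (by simp)
  have h2 := hqz.aeval_ne_zero_of_eval (MvPolynomial.X 0) (fun _ => 1) (by simp)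
  have h3 := hqz.aeval_ne_zero_of_eval (MvPolynomial.X 1) (fun _ => 1) (by simp)
  -- This is the numerator of λ, which gives `r ≠ 0`.
  have h4 := hqz.aeval_ne_zero_of_eval (MvPolynomial.X 1 + 1 - MvPolynomial.X 0) (fun _ => 1)
    (by simp)
  simp only [map_sub, map_add, MvPolynomial.aeval_X, map_one, Matrix.cons_val_zero,
    Matrix.cons_val_one] at h1 h2 h3 h4
  refine ⟨sub_ne_zero.1 h1, h2, h3, fun h0 => ?_, hr⟩
  rw [h0, lam, zero_pow two_ne_zero, eq_comm, div_eq_zero_iff] at hr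
  exact hr.elim h4 (mul_ne_zero h2 h3)

/-- There is a valuation ring of `K` whose residue field sees the specialization `q = z = 1`. -/
theorem exists_valuationSubring_specialization (hqz : AlgebraicIndependent ℤ ![q, z]) :
    ∃ B : ValuationSubring K, B.valuation (q - 1) < 1 ∧ B.valuation (z - 1) < 1 := by
  let χ' : Algebra.adjoin ℤ (Set.range ![q, z]) →+* ℤ :=
    (MvPolynomial.eval fun _ => (1 : ℤ)).comp (RingHomClass.toRingHom hqz.aevalEquiv.symm)
  let χ : (Algebra.adjoin ℤ (Set.range ![q, z])).toSubring →+* ℤ := χ'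
  -- The kernel of evaluation at (1, 1) is a proper ideal of ℤ[q, z] containing `q - 1` and `z - 1`;
  -- some valuation ring of K has it among its nonunits.
  obtain ⟨B, -, hB⟩ := Ideal.image_subset_nonunits_valuationSubring
    (A := (Algebra.adjoin ℤ (Set.range ![q, z])).toSubring) (RingHom.ker χ) (RingHom.ker_ne_top χ)
  have hmem : ∀ i, B.valuation (![q, z] i - 1) < 1 := fun i => by
    rw [← ValuationSubring.mem_nonunits_iff]
    refine hB ⟨hqz.aevalEquiv (MvPolynomial.X i - 1), ?_, ?_⟩
    · change MvPolynomial.eval _ (hqz.aevalEquiv.symm (hqz.aevalEquiv _)) = 0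
      simp
    · change ((hqz.aevalEquiv (MvPolynomial.X i - 1) : Algebra.adjoin ℤ (Set.range ![q, z])) : K) = _
      simp
  exact ⟨B, hmem 0, hmem 1⟩

/-- At q = z = 1 the value of λ is 1, so its square root `r` has valuation 1. Hence `b` is a unit,
and `a` inherits the positivity of `q - 1`. -/
theorem exists_valuationSubring_skein (hqz : AlgebraicIndependent ℤ ![q, z])
    (hr : r ^ 2 = lam q z) : ∃ (B : ValuationSubring K) (a b : B),
      (a : K) = (q - 1) * r ∧ (b : K) = q * r ^ 2 ∧ a ∈ Ideal.jacobson (⊥ : Ideal B) ∧ IsUnit b := by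
  obtain ⟨B, h1, h2⟩ := exists_valuationSubring_specialization hqz
  have hq : B.valuation q = 1 := by
    simpa using B.valuation.map_one_add_of_lt h1
  have hz : B.valuation z = 1 := by
    simpa using B.valuation.map_one_add_of_lt h2
  have hzq : B.valuation (z + 1 - q) = 1 := by
    have := B.valuation.map_one_add_of_lt (Valuation.map_sub_lt B.valuation h2 h1)
    rwa [show 1 + (z - 1 - (q - 1)) = z + 1 - q by ring] at this
  have hr1 : B.valuation r = 1 := by
    have : B.valuation r ^ 2 = 1 := by
      rw [← map_pow, hr, lam, map_div₀, map_mul, hq, hz, hzq]; simp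
    exact sq_eq_one.mp this
  have ha : B.valuation ((q - 1) * r) < 1 := by simpa [hr1] using h1
  have hb : B.valuation (q * r ^ 2) = 1 := by simp [hr1, hq]
  refine ⟨B, ⟨_, (B.valuation_le_one_iff _).1 ha.le⟩, ⟨_, (B.valuation_le_one_iff _).1 hb.le⟩,
    rfl, rfl, ?_, (B.valuation_eq_one_iff _).2 hb⟩
  rw [IsLocalRing.jacobson_eq_maximalIdeal _ bot_ne_top]
  exact (B.valuation_lt_one_iff _).2 ha

end Specialization

/-! ### The systems of equations -/

section Systems

variable {K : Type*} [Field K] {q z r : K} {p : ℤ}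

open ArtinB

/-- A move on another strand is by definition a move on the first strand of a conjugate, and X does
not see the conjugation. -/
theorem eq_bbmDiff {m : ℕ} (α : ArtinB m) (i : Fin (m + 1)) (ε : ℤˣ) :
    invX q z r α - invX q z r (sl p ε i α) =
      bbmDiff q z r p ε ((desc i)⁻¹ * α * desc i) := by
  rw [bbmDiff, sl, invX_mul_comm q z r (_ * α), mul_inv_cancel_left]

theorem bbmDiff_mem_of_mem {S : ∀ m, Set (ArtinB m)} {m : ℕ} {α : ArtinB m} (hα : α ∈ S m)
    (i : Fin (m + 1)) (ε : ℤˣ) :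
    bbmDiff q z r p ε ((desc i)⁻¹ * α * desc i) ∈
      Submodule.span K (bbmEquations q z r p S) :=
  Submodule.subset_span ⟨m, α, i, ε, hα, (eq_bbmDiff α i ε).symm⟩

theorem mono_mem_LambdaSet {m : ℕ} {k : List ℤ} (hk : k.length = m + 1) (hs : k.SortedGE)
    (h0 : (∀ x ∈ k, x ≠ 0) ∨ m = 0) :
    zpowProd (loopSymm t (gen m)) 0 k ∈ LambdaSet m := by
  have hof : List.ofFn (fun i : Fin (m + 1) => k.get (i.cast hk.symm)) = k :=
    List.ext_getElem (by simp [hk]) fun i _ _ => by rw [List.getElem_ofFn]; rfl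
  refine ⟨fun i => k.get (i.cast hk.symm), ⟨?_, fun i j hij => hs (by simpa using hij)⟩, ?_⟩
  · exact h0.imp (fun h i => h _ (List.get_mem _ _)) id
  · rw [mono_eq_zpowProd, hof]

/-- All equations of braid band moves follow from those for the elements of `Λ`. -/
theorem bbmDiff_mem_span (hqz : AlgebraicIndependent ℤ ![q, z]) (hr : r ^ 2 = lam q z) {m : ℕ}
    (ε : ℤˣ) (α : ArtinB m) :
    bbmDiff q z r p ε α ∈ Submodule.span K (bbmEquations q z r p LambdaSet) := by
  have hgen := isGenericParam_of_algebraicIndependent hqz hr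
  induction m generalizing ε with
  | zero =>
    obtain ⟨d, hα⟩ := exists_loopWord α
    obtain ⟨k, -, rfl⟩ := hα.exists_zpow
    have h1 : zpowProd (loopSymm t (gen 0)) 0 [k] ∈ LambdaSet 0 :=
      mono_mem_LambdaSet rfl (by simp [List.sortedGE_iff_pairwise]) (Or.inr rfl)
    simpa [desc, zpowProd, loopSymm] using bbmDiff_mem_of_mem (p := p) h1 0 ε
  | succ m ih =>
    obtain ⟨B, a, b, ha, hb, haJ, hbU⟩ := exists_valuationSubring_skein hqz hr
    set W := Submodule.span K (bbmEquations q z r p LambdaSet) with hW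
    -- The quotient is a K-vector space; Nakayama's lemma is applied to finitely generated
    -- B-submodules of it.
    let _ : Module B (TraceModule K q z ⧸ W) := Module.compHom _ (algebraMap B K)
    have hasmul : ∀ x : TraceModule K q z ⧸ W, a • x = ((q - 1) * r) • x := fun x => ha ▸ rfl
    have hbsmul : ∀ x : TraceModule K q z ⧸ W, b • x = (q * r ^ 2) • x := fun x => hb ▸ rfl
    have hzero : ∀ β : ArtinB (m + 1), W.mkQ (bbmDiff q z r p ε β) = 0 ↔
        bbmDiff q z r p ε β ∈ W := fun β => by simp
    have key : IsMarkedFunctional a b (m + 1) t (gen (m + 1))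
        (fun β : ArtinB (m + 1) => W.mkQ (bbmDiff q z r p ε β)) := by
      refine ⟨fun x y i hi => ?_, fun β i hi hi' => ?_, fun d β hβ => ?_, fun d d' β γ hβ hγ => ?_,
        fun d β hβ => ?_, fun k hk hs hk0 i hi => ?_⟩
      · change W.mkQ _ = a • W.mkQ _ + b • W.mkQ _
        rw [hasmul, hbsmul, gen_of_lt hi, hgen.bbmDiff_hecke, map_add, map_smul, map_smul]
      · rw [gen_of_lt hi', IsGenericParam.bbmDiff_mul_σ p ε β _ hi]
      · obtain ⟨β, rfl⟩ := exists_incl_eq hβ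
        rw [hzero, IsGenericParam.bbmDiff_incl]
        exact W.smul_mem _ (ih ε β)
      · obtain ⟨β, rfl⟩ := exists_incl_eq hβ
        obtain ⟨γ, rfl⟩ := exists_incl_eq hγ
        rw [hzero, gen_of_lt (by omega)]
        change bbmDiff q z r p ε (incl β * σ (Fin.last m) * incl γ) ∈ W
        rw [hgen.bbmDiff_stab]
        exact ih ε _
      · obtain ⟨β, rfl⟩ := exists_incl_eq hβ
        -- This factor is not a unit of `B`, but `W` is a K-subspace, so division by it is
        -- legitimate here.
        have h1 : (q - 1) * r ≠ 0 := mul_ne_zero (sub_ne_zero.2 hgen.q_ne_one) hgen.r_ne_zero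
        rw [hzero, ← W.smul_mem_iff h1, hgen.bbmDiff_split]
        exact W.sub_mem (ih 1 β) (W.smul_mem _ (ih (-1) β))
      · have h1 := bbmDiff_mem_of_mem (q := q) (z := z) (r := r) (p := p)
          (mono_mem_LambdaSet hk hs (Or.inl hk0)) ⟨i, by omega⟩ ε
        rw [hzero]
        rwa [desc_eq_descProd] at h1
    obtain ⟨d, hα⟩ := exists_loopWord α
    exact (hzero α).1 (key.eq_zero (isTypeB _) hbU (Nat.succ_pos m) haJ hα)

/-- One inclusion is monotonicity; the other holds because `bbmDiff_mem_span` covers all mixed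
braids. -/
theorem span_bbmEquations_eq (hqz : AlgebraicIndependent ℤ ![q, z]) (hr : r ^ 2 = lam q z)
    {S : ∀ m, Set (ArtinB m)} (hS : ∀ m, LambdaSet m ⊆ S m) :
    Submodule.span K (bbmEquations q z r p S) =
      Submodule.span K (bbmEquations q z r p LambdaSet) := by
  refine le_antisymm (Submodule.span_le.2 ?_) (Submodule.span_mono ?_)
  · rintro _ ⟨m, α, i, ε, -, rfl⟩
    rw [eq_bbmDiff]
    exact bbmDiff_mem_span hqz hr ε _
  · rintro _ ⟨m, α, i, ε, hα, rfl⟩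
    exact ⟨m, α, i, ε, hS m hα, rfl⟩

theorem LambdaSet_subset_LSet (m : ℕ) : LambdaSet m ⊆ LSet m := by
  rintro _ ⟨k, hk, rfl⟩
  exact ⟨k, hk.1, rfl⟩

theorem LambdaSet_subset_LambdaTailSet (m : ℕ) : LambdaSet m ⊆ LambdaTailSet m := by
  rintro _ ⟨k, hk, rfl⟩
  exact ⟨m, le_rfl, k, 1, Subgroup.one_mem _, hk, (mul_one _).symm⟩

end Systems

theorem mainTheorem2 {K : Type*} [Field K] (q z r : K)
    (hqz : AlgebraicIndependent ℤ ![q, z]) (hr : r ^ 2 = lam q z) (p : ℤ) :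
    EquivSystems (bbmEquations q z r p LambdaTailSet) (bbmEquations q z r p LSet) ∧
      EquivSystems (bbmEquations q z r p LambdaTailSet) (bbmEquations q z r p LambdaSet) := by
  have h1 := span_bbmEquations_eq (p := p) hqz hr LambdaSet_subset_LambdaTailSet
  have h2 := span_bbmEquations_eq (p := p) hqz hr LambdaSet_subset_LSet
  exact ⟨h1.trans h2.symm, h1⟩
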